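/- **Completeness of the $\mathbb B$-reset modal $\mu$-calculus relative to the cyclic modal $\mu$-calculus.** *Formulas.* Let $\mathrm{Prop}$ and $\mathrm{Var}$ be sets of propositional letters and variables. Formulas are given by $\varphi ::= p \mid \neg p \mid x \mid \varphi\wedge\varphi \mid \varphi\vee\varphi \mid \Box\varphi \mid \Diamond\varphi \mid \mu x.\varphi \mid \nu x.\varphi$. Write $x <_\varphi y$ if $\varphi$ has a subformula $\sigma y.\psi$ ($\sigma\in\{\mu,\nu\}$) in which $x$ is free; $\varphi$ is *well-named* if $<_\varphi$ is a strict preorder, i.e. irreflexive and transitive. $\varphi[\psi/x]$ replaces all instances of $x$ by $\psi$ and is defined only if $x$ is not bound in $\varphi$. A word $a\in\{0,1\}^*$ addresses a subformula $\varphi@a$ in the usual way. Let $N(\varphi)$ be the set of addresses $a$ at which $\varphi@a$ has the form $\nu x.\psi$, and $O_x(\varphi)$ the set of addresses of instances of $x$ in $\varphi$ not below a quantifier binding $x$. *Cyclic preproofs.* A preproof over a set of rules is a finite tree labelled by sequents with a partial map $\beta$ from leaves (*buds*) to inner nodes (*companions*) that are proper ancestors of them and carry the same sequent, such that every inner node is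 the conclusion of a rule instance whose premises label its children in order. All sequents in the systems below, including those of rule instances, satisfy the requirements on sequents of the system. Preproofs are required to have no assumptions: every leaf is a bud or the conclusion of a rule without premises. "$\Gamma,\varphi$" means $\Gamma\cup\{\varphi\}$. *The system $K_\mu$.* Sequents are finite sets $\Gamma$ of well-named formulas. The rules (conclusion $\Leftarrow$ premises) are: (Ax) $p,\neg p\Leftarrow$ (no premise); (Wk) $\Gamma,\varphi\Leftarrow\Gamma$; ($\vee$) $\Gamma,\varphi\vee\psi\Leftarrow\Gamma,\varphi,\psi$; ($\wedge$) $\Gamma,\varphi\wedge\psi\Leftarrow\Gamma,\varphi$ and $\Gamma,\psi$; (Mod) $\Diamond\Gamma,\Box\varphi\Leftarrow\Gamma,\varphi$; ($\sigma$) $\Gamma,\sigma x.\varphi\Leftarrow\Gamma,\varphi[\sigma x.\varphi/x]$ for $\sigma\in\{\mu,\nu\}$. Positions of a sequent $\Gamma$ are the pairs $(\varphi,a)$ with $\varphi\in\Gamma$, $a\in N(\varphi)$. Each rule relates positions of its conclusion to positions of each premise by steps with value in $\mathbb B=\{0,1\}$. In all rules but (Mod), context positions $(\psi,a)$, $\psi\in\Gamma$,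 step to themselves with value $0$. In the rules ($\vee$), ($\wedge$), (Mod), a position $(\chi,ia)$ of a formula $\chi$ that the rule decomposes steps with value $0$ to $(\chi',a)$ when the immediate subformula $\chi'=\chi@i$ is the one that the rule puts into the premise. In the rule ($\sigma$), with $\chi=\sigma x.\varphi$ and $\chi'=\varphi[\chi/x]$: $(\chi,0a)$ steps with value $0$ to $(\chi',a)$ and to $(\chi',a'0a)$ for $a\in N(\varphi)$, $a'\in O_x(\varphi)$; and if $\sigma=\nu$, then $(\chi,\varepsilon)$ steps with value $1$ to $(\chi',a')$ for $a'\in O_x(\varphi)$. From a bud to its companion, positions step to themselves with value $0$. A preproof is a *proof* if along some final segment of every infinite branch (starting at the root and passing from buds to their companions) there is a sequence of positions connected by steps, infinitely many of which have value $1$. $K_\mu\vdash\Gamma$ means that some proof has $\Gamma$ at its root. *The system $RK_\mu^{\mathbb B}$.* Annotated formulas are formulas in which every $\nu$-quantifier carries a word $u$ of letters from a fixed countably infinite alphabet, written $\nu^u x.\varphi$. Sequents are expressions $\Theta\mid\Gamma$, where the *control* $\Theta$ is a finite word of distinct letters and $\Gamma$ is a finite set of annotated formulas that are well-named (after removal of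 annotations) and all of whose annotations are subsequences of $\Theta$. For subsequences $u\ne v$ of $\Theta$ put $u<_\Theta v$ if the $\Theta$-first letter occurring in exactly one of them occurs in $u$. For formulas $\varphi,\psi$ which differ only in annotations, $\mathrm{merge}_\Theta(\varphi,\psi)$ has at every $\nu$-quantifier the $<_\Theta$-minimum of the two annotations. A letter $a$ of $\Theta$ is *covered* in $\Gamma$ if no annotation in $\Gamma$ ends in $a$. $\Gamma\!\restriction\! a$ arises from $\Gamma$ by replacing every annotation of the form $uav$ by $ua$. $\Theta'$ denotes $\Theta$ without the letters that occur in no annotation of the premise in question. The rules are: (Ax) $\Theta\mid p,\neg p\Leftarrow$ (no premise); (Wk) $\Theta\mid\Gamma,\varphi\Leftarrow\Theta'\mid\Gamma$; ($\vee$) $\Theta\mid\Gamma,\varphi\vee\psi\Leftarrow\Theta\mid\Gamma,\varphi,\psi$; ($\wedge$) $\Theta\mid\Gamma,\varphi\wedge\psi\Leftarrow\Theta'\mid\Gamma,\varphi$ and $\Theta'\mid\Gamma,\psi$; (Mod) $\Theta\mid\Diamond\Gamma,\Box\varphi\Leftarrow\Theta\mid\Gamma,\varphi$; ($\mu$) $\Theta\mid\Gamma,\mu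 x.\varphi\Leftarrow\Theta\mid\Gamma,\varphi[\mu x.\varphi/x]$; ($\nu$) $\Theta\mid\Gamma,\nu^u x.\varphi\Leftarrow\Theta a\mid\Gamma,\varphi[\nu^{ua}x.\varphi/x]$ with $a\notin\Theta$; ($\mathrm{Reset}_a$) $\Theta\mid\Gamma\Leftarrow\Theta'\mid\Gamma\!\restriction\! a$ with $a\in\Theta$ covered in $\Gamma$; (Merge) $\Theta\mid\Gamma,\varphi,\psi\Leftarrow\Theta'\mid\Gamma,\mathrm{merge}_\Theta(\varphi,\psi)$. A preproof is a *proof* if for every bud $t$ there is a letter $a$ that occurs in all controls on the path from $\beta(t)$ to $t$, preceded by the same prefix in all of them, and such that $\mathrm{Reset}_a$ is applied on this path. $RK_\mu^{\mathbb B}\vdash\Gamma$ means that some proof has $\varepsilon\mid\Gamma^\varepsilon$ at its root, where all annotations in $\Gamma^\varepsilon$ are empty. **Statement.** For every finite set $\Gamma$ of well-named formulas: if $K_\mu\vdash\Gamma$, then $RK_\mu^{\mathbb B}\vdash\Gamma$. -/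

import Mathlib

namespace ModalMu

universe u v w

/-! ### Cyclic trees, derivation systems, cyclic proof systems -/

/-- A node of `T` without children.  The children of `t` are the words `t ++ [i]` in `T`. -/
def IsLeaf (T : Set (List ℕ)) (t : List ℕ) : Prop := t ∈ T ∧ ∀ i, t ++ [i] ∉ T

/-- A node of `T` with a child. -/
def IsInner (T : Set (List ℕ)) (t : List ℕ) : Prop := t ∈ T ∧ ∃ i, t ++ [i] ∈ T

/-- A finite tree (a nonempty prefix-closed set of words) with a partial function `back` from
leaves ("buds") to inner nodes ("companions") that lie strictly below them in the prefix order. -/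
structure CyclicTree where
  nodes : Set (List ℕ)
  finite : nodes.Finite
  nonempty : nodes.Nonempty
  prefix_closed : ∀ ⦃s t : List ℕ⦄, s <+: t → t ∈ nodes → s ∈ nodes
  back : List ℕ → Option (List ℕ)
  back_leaf : ∀ ⦃t c : List ℕ⦄, back t = some c → IsLeaf nodes t
  back_inner : ∀ ⦃t c : List ℕ⦄, back t = some c → IsInner nodes c
  back_lt : ∀ ⦃t c : List ℕ⦄, back t = some c → c <+: t ∧ c ≠ t

/-- Sequents, rules, and for each rule `R` the tuple
`(concl R, prem R 0, …, prem R (arity R - 1))`. -/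
structure DerivationSystem where
  Seq : Type u
  Rule : Type u
  arity : Rule → ℕ
  concl : Rule → Seq
  prem : (R : Rule) → Fin (arity R) → Seq

/-- Preproofs.  `rule` is a partial function on the nodes that are not buds; the value of `label`
outside the tree is irrelevant. -/
structure Preproof (D : DerivationSystem.{u}) where
  tree : CyclicTree
  label : List ℕ → D.Seq
  rule : List ℕ → Option D.Rule
  label_back : ∀ ⦃t c : List ℕ⦄, tree.back t = some c → label t = label c
  rule_node : ∀ ⦃t : List ℕ⦄ ⦃R : D.Rule⦄, rule t = some R → t ∈ tree.nodes ∧ tree.back t = none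
  rule_concl : ∀ ⦃t : List ℕ⦄ ⦃R : D.Rule⦄, rule t = some R → label t = D.concl R
  rule_children : ∀ ⦃t : List ℕ⦄ ⦃R : D.Rule⦄, rule t = some R →
    ∀ i : ℕ, t ++ [i] ∈ tree.nodes ↔ i < D.arity R
  rule_prem : ∀ ⦃t : List ℕ⦄ ⦃R : D.Rule⦄, rule t = some R →
    ∀ i : Fin (D.arity R), label (t ++ [(i : ℕ)]) = D.prem R i
  leaf_of_no_rule : ∀ ⦃t : List ℕ⦄, t ∈ tree.nodes → tree.back t = none → rule t = none →
    IsLeaf tree.nodes t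

/-- The sequent at the root. -/
def Preproof.endsequent {D : DerivationSystem.{u}} (pf : Preproof D) : D.Seq := pf.label []

/-- There are no assumptions: every leaf is a bud or the conclusion of a rule. -/
def Preproof.Closed {D : DerivationSystem.{u}} (pf : Preproof D) : Prop :=
  ∀ t, IsLeaf pf.tree.nodes t → pf.tree.back t = none → ∃ R, pf.rule t = some R

/-- A derivation system with a set of assumption-free preproofs, its proofs. -/
structure CyclicProofSystem extends DerivationSystem.{u} where
  proofs : Set (Preproof toDerivationSystem)
  closed : ∀ pf ∈ proofs, pf.Closed

/-- `S ⊢ Γ`. -/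
def CyclicProofSystem.Proves (S : CyclicProofSystem.{u}) (Γ : S.Seq) : Prop :=
  ∃ pf ∈ S.proofs, pf.endsequent = Γ

/-! ### Activated traces and the global trace condition -/

/-- A finite join-semilattice with least element and an activation element distinct from it. -/
class ActivationAlgebra (A : Type*) extends SemilatticeSup A, OrderBot A where
  act : A
  bot_ne_act : (⊥ : A) ≠ act
  finite : Finite A

/-- The booleans, with activation element `1`. -/
instance : ActivationAlgebra Bool where
  __ := (inferInstance : DistribLattice Bool)
  __ := (inferInstance : BoundedOrder Bool)
  act := true
  bot_ne_act := by decide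
  finite := inferInstance

/-- Morphisms between subsets of `U` are relations `R ⊆ U × A × U` (supported on the source and
the target). -/
abbrev TraceRel (U : Type u) (A : Type v) := U → A → U → Prop

/-- The identity `{(x, 0, x) | x ∈ X}`. -/
def TraceRel.id {U : Type u} {A : Type v} [ActivationAlgebra A] (X : Set U) : TraceRel U A :=
  fun x c y => x ∈ X ∧ c = ⊥ ∧ x = y

/-- First `R`, then `R'`, joining the activation values. -/
def TraceRel.comp {U : Type u} {A : Type v} [ActivationAlgebra A] (R R' : TraceRel U A) :
    TraceRel U A :=
  fun x c z => ∃ y a b, R x a y ∧ R' y b z ∧ a ⊔ b = c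

/-- For the path with objects `X i` and steps `R i : X i → X (i + 1)`, the morphism
`X i → X (i + n)`. -/
def pathSegment {U : Type u} {A : Type v} [ActivationAlgebra A] (X : ℕ → Set U)
    (R : ℕ → TraceRel U A) (i : ℕ) : ℕ → TraceRel U A
  | 0 => TraceRel.id (X i)
  | n + 1 => (pathSegment X R i n).comp (R (i + n))

/-- There are a subpath, given by a strictly increasing `S`, and a sequence of elements along it
all of whose steps are activated. -/
def TraceCondition {U : Type u} {A : Type v} [ActivationAlgebra A] (X : ℕ → Set U)
    (R : ℕ → TraceRel U A) : Prop :=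
  ∃ S : ℕ → ℕ, StrictMono S ∧ ∃ x : ℕ → U, ∀ i, x i ∈ X (S i) ∧
    pathSegment X R (S i) (S (i + 1) - S i) (x i) ActivationAlgebra.act (x (i + 1))

/-- A finite set for every sequent, and for every rule a relation from the set of the conclusion
to that of each premise. -/
structure TraceInterpretation (D : DerivationSystem.{u}) (U : Type w) (A : Type*)
    [ActivationAlgebra A] where
  obj : D.Seq → Set U
  obj_finite : ∀ Γ, (obj Γ).Finite
  map : (R : D.Rule) → Fin (D.arity R) → TraceRel U A
  map_support : ∀ R i x a y, map R i x a y → x ∈ obj (D.concl R) ∧ y ∈ obj (D.prem R i)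

/-- An infinite branch: it starts at the root, passes from inner nodes to children and from buds
to their companions. -/
def CyclicTree.IsBranch (C : CyclicTree) (π : ℕ → List ℕ) : Prop :=
  π 0 = [] ∧ ∀ i, π i ∈ C.nodes ∧
    (IsInner C.nodes (π i) → ∃ j, π (i + 1) = π i ++ [j]) ∧
    (IsLeaf C.nodes (π i) → C.back (π i) = some (π (i + 1)))

/-- The objects of the path induced by a branch. -/
def Preproof.pathObj {D : DerivationSystem.{u}} {U : Type w} {A : Type*} [ActivationAlgebra A]
    (pf : Preproof D) (ι : TraceInterpretation D U A) (π : ℕ → List ℕ) (i : ℕ) : Set U :=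
  ι.obj (pf.label (π i))

/-- The steps of the path induced by a branch: the trace map of the rule from a node to its child,
the identity from a bud to its companion. -/
def Preproof.pathStep {D : DerivationSystem.{u}} {U : Type w} {A : Type*} [ActivationAlgebra A]
    (pf : Preproof D) (ι : TraceInterpretation D U A) (π : ℕ → List ℕ) (i : ℕ) : TraceRel U A :=
  fun x a y =>
    (∃ (R : D.Rule) (j : Fin (D.arity R)), pf.rule (π i) = some R ∧ π (i + 1) = π i ++ [(j : ℕ)] ∧
      ι.map R j x a y) ∨
    (pf.tree.back (π i) ≠ none ∧ TraceRel.id (pf.pathObj ι π i) x a y)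

/-- The cyclic proof system induced by a trace interpretation: the proofs are the assumption-free
preproofs all of whose branches satisfy the trace condition. -/
def TraceInterpretation.system {D : DerivationSystem.{u}} {U : Type w} {A : Type*}
    [ActivationAlgebra A] (ι : TraceInterpretation D U A) : CyclicProofSystem.{u} where
  toDerivationSystem := D
  proofs := {pf | pf.Closed ∧
    ∀ π, pf.tree.IsBranch π → TraceCondition (pf.pathObj ι π) (pf.pathStep ι π)}
  closed := fun _ h => h.1

/-! ### Formulas of the modal mu-calculus -/

/-- `P` are the propositional letters, `V` the variables. -/
inductive Form (P : Type u) (V : Type v) where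
  | prop (p : P)
  | nprop (p : P)
  | var (x : V)
  | and (φ ψ : Form P V)
  | or (φ ψ : Form P V)
  | box (φ : Form P V)
  | dia (φ : Form P V)
  | mu (x : V) (φ : Form P V)
  | nu (x : V) (φ : Form P V)

namespace Form

variable {P : Type u} {V : Type v}

/-- `x` occurs free. -/
def Free (x : V) : Form P V → Prop
  | prop _ => False
  | nprop _ => False
  | var y => y = x
  | and φ ψ => Free x φ ∨ Free x ψ
  | or φ ψ => Free x φ ∨ Free x ψ
  | box φ => Free x φ
  | dia φ => Free x φ
  | mu y φ => y ≠ x ∧ Free x φ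
  | nu y φ => y ≠ x ∧ Free x φ

/-- Some quantifier binds `x`. -/
def Bound (x : V) : Form P V → Prop
  | prop _ => False
  | nprop _ => False
  | var _ => False
  | and φ ψ => Bound x φ ∨ Bound x ψ
  | or φ ψ => Bound x φ ∨ Bound x ψ
  | box φ => Bound x φ
  | dia φ => Bound x φ
  | mu y φ => y = x ∨ Bound x φ
  | nu y φ => y = x ∨ Bound x φ

open Classical in
/-- `φ[χ / x]`: all instances of `x` are replaced by `χ`.  It is used only if `x` is not bound
in `φ`. -/
noncomputable def subst : Form P V → V → Form P V → Form P V
  | prop p, _, _ => prop p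
  | nprop p, _, _ => nprop p
  | var y, x, χ => if y = x then χ else var y
  | and φ ψ, x, χ => and (subst φ x χ) (subst ψ x χ)
  | or φ ψ, x, χ => or (subst φ x χ) (subst ψ x χ)
  | box φ, x, χ => box (subst φ x χ)
  | dia φ, x, χ => dia (subst φ x χ)
  | mu y φ, x, χ => mu y (subst φ x χ)
  | nu y φ, x, χ => nu y (subst φ x χ)

/-- The subformula at an address (`false` is the digit `0`, `true` the digit `1`). -/
def at? : Form P V → List Bool → Option (Form P V)
  | prop p => fun
    | [] => some (prop p)
    | _ :: _ => none
  | nprop p => fun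
    | [] => some (nprop p)
    | [false] => some (prop p)
    | _ => none
  | var x => fun
    | [] => some (var x)
    | _ :: _ => none
  | and φ ψ => fun
    | [] => some (and φ ψ)
    | false :: a => at? φ a
    | true :: a => at? ψ a
  | or φ ψ => fun
    | [] => some (or φ ψ)
    | false :: a => at? φ a
    | true :: a => at? ψ a
  | box φ => fun
    | [] => some (box φ)
    | false :: a => at? φ a
    | true :: _ => none
  | dia φ => fun
    | [] => some (dia φ)
    | false :: a => at? φ a
    | true :: _ => none
  | mu x φ => fun
    | [] => some (mu x φ)
    | false :: a => at? φ a
    | true :: _ => none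
  | nu x φ => fun
    | [] => some (nu x φ)
    | false :: a => at? φ a
    | true :: _ => none

/-- The addresses of greatest fixed-point quantifiers. -/
def nuAddr (φ : Form P V) : Set (List Bool) := {a | ∃ x ψ, φ.at? a = some (nu x ψ)}

/-- The addresses of the instances of `x` that lie below no quantifier for `x`. -/
def openAddr (x : V) (φ : Form P V) : Set (List Bool) :=
  {a | φ.at? a = some (var x) ∧ ∀ a', a' <+: a → a' ≠ a → ∀ ψ,
    φ.at? a' ≠ some (nu x ψ) ∧ φ.at? a' ≠ some (mu x ψ)}

/-- `x` subsumes `y` in `φ`: `φ` has a subformula `σ y. ψ` in which `x` is free. -/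
def Subsumes (φ : Form P V) (x y : V) : Prop :=
  ∃ a ψ, (φ.at? a = some (mu y ψ) ∧ Free x (mu y ψ)) ∨ (φ.at? a = some (nu y ψ) ∧ Free x (nu y ψ))

/-- Subsumption is a strict preorder, i.e. irreflexive and transitive. -/
def WellNamed (φ : Form P V) : Prop :=
  (∀ x, ¬ φ.Subsumes x x) ∧ ∀ x y z, φ.Subsumes x y → φ.Subsumes y z → φ.Subsumes x z

theorem finite_addr (φ : Form P V) : {a | φ.at? a ≠ none}.Finite := by
  have key : ∀ (χ : Form P V) (S T : Set (List Bool)), S.Finite → T.Finite →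
      (∀ a, χ.at? a ≠ none → a = [] ∨ (∃ b ∈ S, a = false :: b) ∨ ∃ b ∈ T, a = true :: b) →
      {a | χ.at? a ≠ none}.Finite := by
    intro χ S T hS hT h
    refine (((hS.image (List.cons false)).union (hT.image (List.cons true))).insert []).subset ?_
    intro a ha
    rcases h a ha with h | ⟨b, hb, rfl⟩ | ⟨b, hb, rfl⟩
    · exact Or.inl h
    · exact Or.inr (Or.inl ⟨b, hb, rfl⟩)
    · exact Or.inr (Or.inr ⟨b, hb, rfl⟩)
  induction φ with
  | prop p =>
    refine key _ ∅ ∅ Set.finite_empty Set.finite_empty ?_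
    rintro (_ | ⟨_ | _, a⟩) h
    exacts [Or.inl rfl, absurd rfl h, absurd rfl h]
  | nprop p =>
    refine key _ {[]} ∅ (Set.finite_singleton _) Set.finite_empty ?_
    rintro (_ | ⟨_ | _, _ | ⟨_, _⟩⟩) h
    exacts [Or.inl rfl, Or.inr (Or.inl ⟨[], rfl, rfl⟩), absurd rfl h, absurd rfl h, absurd rfl h]
  | var x =>
    refine key _ ∅ ∅ Set.finite_empty Set.finite_empty ?_
    rintro (_ | ⟨_ | _, a⟩) h
    exacts [Or.inl rfl, absurd rfl h, absurd rfl h]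
  | and φ ψ h₁ h₂ =>
    refine key _ _ _ h₁ h₂ ?_
    rintro (_ | ⟨_ | _, a⟩) h
    exacts [Or.inl rfl, Or.inr (Or.inl ⟨a, h, rfl⟩), Or.inr (Or.inr ⟨a, h, rfl⟩)]
  | or φ ψ h₁ h₂ =>
    refine key _ _ _ h₁ h₂ ?_
    rintro (_ | ⟨_ | _, a⟩) h
    exacts [Or.inl rfl, Or.inr (Or.inl ⟨a, h, rfl⟩), Or.inr (Or.inr ⟨a, h, rfl⟩)]
  | box φ h₁ =>
    refine key _ _ ∅ h₁ Set.finite_empty ?_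
    rintro (_ | ⟨_ | _, a⟩) h
    exacts [Or.inl rfl, Or.inr (Or.inl ⟨a, h, rfl⟩), absurd rfl h]
  | dia φ h₁ =>
    refine key _ _ ∅ h₁ Set.finite_empty ?_
    rintro (_ | ⟨_ | _, a⟩) h
    exacts [Or.inl rfl, Or.inr (Or.inl ⟨a, h, rfl⟩), absurd rfl h]
  | mu x φ h₁ =>
    refine key _ _ ∅ h₁ Set.finite_empty ?_
    rintro (_ | ⟨_ | _, a⟩) h
    exacts [Or.inl rfl, Or.inr (Or.inl ⟨a, h, rfl⟩), absurd rfl h]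
  | nu x φ h₁ =>
    refine key _ _ ∅ h₁ Set.finite_empty ?_
    rintro (_ | ⟨_ | _, a⟩) h
    exacts [Or.inl rfl, Or.inr (Or.inl ⟨a, h, rfl⟩), absurd rfl h]

theorem nuAddr_finite (φ : Form P V) : φ.nuAddr.Finite :=
  φ.finite_addr.subset fun a ⟨x, ψ, h⟩ => by simp [h]

end Form

/-! ### The cyclic system of the modal mu-calculus, with traces in the booleans -/

/-- Finite sets of well-named formulas. -/
@[ext]
structure KSeq (P : Type u) (V : Type v) where
  forms : Set (Form P V)
  wf : forms.Finite ∧ ∀ φ ∈ forms, φ.WellNamed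

/-- Instances of rule schemas, given by the context `Γ` and the parameters of the principal
formula. -/
inductive KRaw (P : Type u) (V : Type v) where
  | ax (p : P)
  | wk (Γ : Set (Form P V)) (φ : Form P V)
  | or (Γ : Set (Form P V)) (φ ψ : Form P V)
  | and (Γ : Set (Form P V)) (φ ψ : Form P V)
  | mod (Γ : Set (Form P V)) (φ : Form P V)
  | mu (Γ : Set (Form P V)) (x : V) (φ : Form P V)
  | nu (Γ : Set (Form P V)) (x : V) (φ : Form P V)

namespace KRaw

variable {P : Type u} {V : Type v}

def concl : KRaw P V → Set (Form P V)
  | ax p => {.prop p, .nprop p}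
  | wk Γ φ => Γ ∪ {φ}
  | or Γ φ ψ => Γ ∪ {.or φ ψ}
  | and Γ φ ψ => Γ ∪ {.and φ ψ}
  | mod Γ φ => Form.dia '' Γ ∪ {.box φ}
  | mu Γ x φ => Γ ∪ {.mu x φ}
  | nu Γ x φ => Γ ∪ {.nu x φ}

noncomputable def prems : KRaw P V → List (Set (Form P V))
  | ax _ => []
  | wk Γ _ => [Γ]
  | or Γ φ ψ => [Γ ∪ {φ, ψ}]
  | and Γ φ ψ => [Γ ∪ {φ}, Γ ∪ {ψ}]
  | mod Γ φ => [Γ ∪ {φ}]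
  | mu Γ x φ => [Γ ∪ {φ.subst x (.mu x φ)}]
  | nu Γ x φ => [Γ ∪ {φ.subst x (.nu x φ)}]

/-- The substitution in the fixed-point rules is defined. -/
def Side : KRaw P V → Prop
  | mu _ x φ => ¬ φ.Bound x
  | nu _ x φ => ¬ φ.Bound x
  | _ => True

end KRaw

/-- Rule instances: the side conditions hold and all sequents are finite sets of well-named
formulas. -/
structure KRule (P : Type u) (V : Type v) where
  raw : KRaw P V
  side : raw.Side
  concl_wf : raw.concl.Finite ∧ ∀ φ ∈ raw.concl, φ.WellNamed
  prems_wf : ∀ Δ ∈ raw.prems, Δ.Finite ∧ ∀ φ ∈ Δ, φ.WellNamed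

/-- The derivation system. -/
noncomputable def KDer (P : Type u) (V : Type v) : DerivationSystem.{max u v} where
  Seq := KSeq P V
  Rule := KRule P V
  arity R := R.raw.prems.length
  concl R := ⟨R.raw.concl, R.concl_wf⟩
  prem R i := ⟨R.raw.prems.get i, R.prems_wf _ (List.get_mem _ i)⟩

section Trace

variable {P : Type u} {V : Type v}

/-- The greatest fixed-point quantifier instances of a set of formulas. -/
def nuPositions (Γ : Set (Form P V)) : Set (Form P V × List Bool) :=
  {w | w.1 ∈ Γ ∧ w.2 ∈ w.1.nuAddr}

theorem nuPositions_finite {Γ : Set (Form P V)} (h : Γ.Finite) : (nuPositions Γ).Finite := by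
  refine (h.biUnion (t := fun φ => (fun a => (φ, a)) '' φ.nuAddr)
    fun φ _ => (φ.nuAddr_finite).image _).subset ?_
  rintro ⟨φ, a⟩ ⟨h₁, h₂⟩
  exact Set.mem_biUnion h₁ ⟨a, h₂, rfl⟩

/-- `{(w, 0, w) | w a position of Γ}`. -/
def traceCtx (Γ : Set (Form P V)) : TraceRel (Form P V × List Bool) Bool :=
  fun w c w' => w ∈ nuPositions Γ ∧ c = false ∧ w' = w

/-- `{((χ, i a), 0, (χ', a))}`, for an immediate subformula `χ'` of `χ` in direction `i`. -/
def traceSub (χ : Form P V) (i : Bool) (χ' : Form P V) :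
    TraceRel (Form P V × List Bool) Bool :=
  fun w c w' => ∃ a, w = (χ, i :: a) ∧ c = false ∧ w' = (χ', a)

/-- Traces from the principal formula `χ = σ x. φ` of a fixed-point rule to its unfolding
`χ' = φ[χ / x]`; `b` is the value on the unfolded quantifier. -/
def traceFix (χ : Form P V) (x : V) (φ χ' : Form P V) (b : Bool) :
    TraceRel (Form P V × List Bool) Bool :=
  fun w c w' =>
    (∃ a ∈ φ.openAddr x, w = (χ, []) ∧ c = b ∧ w' = (χ', a)) ∨
    (∃ a ∈ φ.nuAddr, w = (χ, false :: a) ∧ c = false ∧ w' = (χ', a)) ∨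
    (∃ a ∈ φ.nuAddr, ∃ a' ∈ φ.openAddr x,
      w = (χ, false :: a) ∧ c = false ∧ w' = (χ', a' ++ false :: a))

/-- How quantifier instances are tracked from the conclusion to premise number `i`. -/
noncomputable def KRaw.trace : KRaw P V → ℕ → TraceRel (Form P V × List Bool) Bool
  | .ax _, _ => fun _ _ _ => False
  | .wk Γ _, _ => traceCtx Γ
  | .or Γ φ ψ, _ => fun w c w' => traceCtx Γ w c w' ∨
      traceSub (.or φ ψ) false φ w c w' ∨ traceSub (.or φ ψ) true ψ w c w'
  | .and Γ φ ψ, 0 => fun w c w' => traceCtx Γ w c w' ∨ traceSub (.and φ ψ) false φ w c w'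
  | .and Γ φ ψ, _ + 1 => fun w c w' => traceCtx Γ w c w' ∨ traceSub (.and φ ψ) true ψ w c w'
  | .mod Γ φ, _ => fun w c w' =>
      (∃ ψ ∈ Γ, traceSub (.dia ψ) false ψ w c w') ∨ traceSub (.box φ) false φ w c w'
  | .mu Γ x φ, _ => fun w c w' => traceCtx Γ w c w' ∨
      traceFix (.mu x φ) x φ (φ.subst x (.mu x φ)) false w c w'
  | .nu Γ x φ, _ => fun w c w' => traceCtx Γ w c w' ∨
      traceFix (.nu x φ) x φ (φ.subst x (.nu x φ)) true w c w'

end Trace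

/-- The trace interpretation in the booleans.  The relations are restricted to the positions of
the conclusion and the premise, which discards the `ε`-clause of `traceFix` for `μ`. -/
noncomputable def KTrace (P : Type u) (V : Type v) :
    TraceInterpretation (KDer P V) (Form P V × List Bool) Bool where
  obj Γ := nuPositions Γ.forms
  obj_finite Γ := nuPositions_finite Γ.wf.1
  map R i := fun w c w' => w ∈ nuPositions R.raw.concl ∧ w' ∈ nuPositions (R.raw.prems.get i) ∧
    R.raw.trace i w c w'
  map_support := fun _ _ _ _ _ h => ⟨h.1, h.2.1⟩

/-- The cyclic proof system of the modal mu-calculus. -/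
noncomputable def Kmu (P : Type u) (V : Type v) : CyclicProofSystem.{max u v} :=
  (KTrace P V).system

/-! ### Annotated formulas -/

/-- Formulas whose greatest fixed-point quantifiers carry a word of letters (natural numbers). -/
inductive BForm (P : Type u) (V : Type v) where
  | prop (p : P)
  | nprop (p : P)
  | var (x : V)
  | and (φ ψ : BForm P V)
  | or (φ ψ : BForm P V)
  | box (φ : BForm P V)
  | dia (φ : BForm P V)
  | mu (x : V) (φ : BForm P V)
  | nu (u : List ℕ) (x : V) (φ : BForm P V)

/-- `φ^ε`: all annotations are empty. -/
def Form.annot {P : Type u} {V : Type v} : Form P V → BForm P V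
  | .prop p => .prop p
  | .nprop p => .nprop p
  | .var x => .var x
  | .and φ ψ => .and φ.annot ψ.annot
  | .or φ ψ => .or φ.annot ψ.annot
  | .box φ => .box φ.annot
  | .dia φ => .dia φ.annot
  | .mu x φ => .mu x φ.annot
  | .nu x φ => .nu [] x φ.annot

/-- For `u ≠ v` subsequences of `Θ`: `u` contains the `Θ`-least letter that occurs in exactly one
of `u` and `v`. -/
def StackLt (Θ u v : List ℕ) : Prop :=
  ∃ s a t, Θ = s ++ a :: t ∧ a ∈ u ∧ a ∉ v ∧ ∀ b ∈ s, (b ∈ u ↔ b ∈ v)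

open Classical in
/-- The minimum of two subsequences of `Θ` with respect to `StackLt Θ`. -/
noncomputable def stackMin (Θ u v : List ℕ) : List ℕ := if StackLt Θ u v then u else v

/-- `u` is cut off after the letter `a`; it is unchanged if `a` does not occur. -/
def resetWord (a : ℕ) (u : List ℕ) : List ℕ :=
  if a ∈ u then u.takeWhile (fun b => b ≠ a) ++ [a] else u

namespace BForm

variable {P : Type u} {V : Type v}

/-- Removal of all annotations. -/
def erase : BForm P V → Form P V
  | prop p => .prop p
  | nprop p => .nprop p
  | var x => .var x
  | and φ ψ => .and φ.erase ψ.erase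
  | or φ ψ => .or φ.erase ψ.erase
  | box φ => .box φ.erase
  | dia φ => .dia φ.erase
  | mu x φ => .mu x φ.erase
  | nu _ x φ => .nu x φ.erase

open Classical in
/-- `φ[χ / x]`, used only if `x` is not bound in `φ`. -/
noncomputable def subst : BForm P V → V → BForm P V → BForm P V
  | prop p, _, _ => prop p
  | nprop p, _, _ => nprop p
  | var y, x, χ => if y = x then χ else var y
  | and φ ψ, x, χ => and (subst φ x χ) (subst ψ x χ)
  | or φ ψ, x, χ => or (subst φ x χ) (subst ψ x χ)
  | box φ, x, χ => box (subst φ x χ)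
  | dia φ, x, χ => dia (subst φ x χ)
  | mu y φ, x, χ => mu y (subst φ x χ)
  | nu u y φ, x, χ => nu u y (subst φ x χ)

/-- The annotations occurring in a formula. -/
def annots : BForm P V → Set (List ℕ)
  | prop _ => ∅
  | nprop _ => ∅
  | var _ => ∅
  | and φ ψ => φ.annots ∪ ψ.annots
  | or φ ψ => φ.annots ∪ ψ.annots
  | box φ => φ.annots
  | dia φ => φ.annots
  | mu _ φ => φ.annots
  | nu u _ φ => {u} ∪ φ.annots

/-- The reset operation for the letter `a`. -/
def reset (a : ℕ) : BForm P V → BForm P V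
  | prop p => prop p
  | nprop p => nprop p
  | var x => var x
  | and φ ψ => and (reset a φ) (reset a ψ)
  | or φ ψ => or (reset a φ) (reset a ψ)
  | box φ => box (reset a φ)
  | dia φ => dia (reset a φ)
  | mu x φ => mu x (reset a φ)
  | nu u x φ => nu (resetWord a u) x (reset a φ)

/-- The graph of the partial function `merge_Θ`, which is defined on formulas that agree up to
annotations and whose annotations are subsequences of `Θ`. -/
inductive Merge (Θ : List ℕ) : BForm P V → BForm P V → BForm P V → Prop
  | prop (p : P) : Merge Θ (.prop p) (.prop p) (.prop p)
  | nprop (p : P) : Merge Θ (.nprop p) (.nprop p) (.nprop p)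
  | var (x : V) : Merge Θ (.var x) (.var x) (.var x)
  | and {φ₀ φ₁ ψ₀ ψ₁ ξ₀ ξ₁ : BForm P V} : Merge Θ φ₀ ψ₀ ξ₀ → Merge Θ φ₁ ψ₁ ξ₁ →
      Merge Θ (.and φ₀ φ₁) (.and ψ₀ ψ₁) (.and ξ₀ ξ₁)
  | or {φ₀ φ₁ ψ₀ ψ₁ ξ₀ ξ₁ : BForm P V} : Merge Θ φ₀ ψ₀ ξ₀ → Merge Θ φ₁ ψ₁ ξ₁ →
      Merge Θ (.or φ₀ φ₁) (.or ψ₀ ψ₁) (.or ξ₀ ξ₁)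
  | box {φ ψ ξ : BForm P V} : Merge Θ φ ψ ξ → Merge Θ (.box φ) (.box ψ) (.box ξ)
  | dia {φ ψ ξ : BForm P V} : Merge Θ φ ψ ξ → Merge Θ (.dia φ) (.dia ψ) (.dia ξ)
  | mu {φ ψ ξ : BForm P V} (x : V) : Merge Θ φ ψ ξ → Merge Θ (.mu x φ) (.mu x ψ) (.mu x ξ)
  | nu {φ ψ ξ : BForm P V} (u v : List ℕ) (x : V) : u.Sublist Θ → v.Sublist Θ →
      Merge Θ φ ψ ξ → Merge Θ (.nu u x φ) (.nu v x ψ) (.nu (stackMin Θ u v) x ξ)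

end BForm

/-! ### The boolean reset system of the modal mu-calculus -/

/-- Expressions `Θ | Γ`. -/
structure BRawSeq (P : Type u) (V : Type v) where
  control : List ℕ
  forms : Set (BForm P V)

/-- The control consists of distinct letters, the formulas are finitely many, well-named up to
annotations, and annotated with subsequences of the control. -/
def BRawSeq.WF {P : Type u} {V : Type v} (s : BRawSeq P V) : Prop :=
  s.control.Nodup ∧ s.forms.Finite ∧
    ∀ φ ∈ s.forms, φ.erase.WellNamed ∧ ∀ u ∈ φ.annots, u.Sublist s.control

/-- Sequents. -/
@[ext]
structure BSeq (P : Type u) (V : Type v) where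
  raw : BRawSeq P V
  wf : raw.WF

/-- The letter `a` occurs in an annotation in `Γ`. -/
def Occurs {P : Type u} {V : Type v} (a : ℕ) (Γ : Set (BForm P V)) : Prop :=
  ∃ φ ∈ Γ, ∃ u ∈ φ.annots, a ∈ u

/-- The letter `a` is not at the last position of any annotation in `Γ`. -/
def Covered {P : Type u} {V : Type v} (a : ℕ) (Γ : Set (BForm P V)) : Prop :=
  ∀ φ ∈ Γ, ∀ u ∈ φ.annots, u.getLast? ≠ some a

open Classical in
/-- `Θ' | Γ`, where all letters not occurring in `Γ` are removed from `Θ`. -/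
noncomputable def trim {P : Type u} {V : Type v} (Θ : List ℕ) (Γ : Set (BForm P V)) :
    BRawSeq P V :=
  ⟨Θ.filter (fun a => decide (Occurs a Γ)), Γ⟩

/-- Instances of rule schemas. -/
inductive BRaw (P : Type u) (V : Type v) where
  | ax (Θ : List ℕ) (p : P)
  | wk (Θ : List ℕ) (Γ : Set (BForm P V)) (φ : BForm P V)
  | or (Θ : List ℕ) (Γ : Set (BForm P V)) (φ ψ : BForm P V)
  | and (Θ : List ℕ) (Γ : Set (BForm P V)) (φ ψ : BForm P V)
  | mod (Θ : List ℕ) (Γ : Set (BForm P V)) (φ : BForm P V)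
  | mu (Θ : List ℕ) (Γ : Set (BForm P V)) (x : V) (φ : BForm P V)
  | nu (Θ : List ℕ) (Γ : Set (BForm P V)) (u : List ℕ) (x : V) (φ : BForm P V) (a : ℕ)
  | reset (Θ : List ℕ) (Γ : Set (BForm P V)) (a : ℕ)
  | merge (Θ : List ℕ) (Γ : Set (BForm P V)) (φ ψ ξ : BForm P V)

namespace BRaw

variable {P : Type u} {V : Type v}

def concl : BRaw P V → BRawSeq P V
  | ax Θ p => ⟨Θ, {.prop p, .nprop p}⟩
  | wk Θ Γ φ => ⟨Θ, Γ ∪ {φ}⟩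
  | or Θ Γ φ ψ => ⟨Θ, Γ ∪ {.or φ ψ}⟩
  | and Θ Γ φ ψ => ⟨Θ, Γ ∪ {.and φ ψ}⟩
  | mod Θ Γ φ => ⟨Θ, BForm.dia '' Γ ∪ {.box φ}⟩
  | mu Θ Γ x φ => ⟨Θ, Γ ∪ {.mu x φ}⟩
  | nu Θ Γ u x φ _ => ⟨Θ, Γ ∪ {.nu u x φ}⟩
  | reset Θ Γ _ => ⟨Θ, Γ⟩
  | merge Θ Γ φ ψ _ => ⟨Θ, Γ ∪ {φ, ψ}⟩

noncomputable def prems : BRaw P V → List (BRawSeq P V)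
  | ax _ _ => []
  | wk Θ Γ _ => [trim Θ Γ]
  | or Θ Γ φ ψ => [⟨Θ, Γ ∪ {φ, ψ}⟩]
  | and Θ Γ φ ψ => [trim Θ (Γ ∪ {φ}), trim Θ (Γ ∪ {ψ})]
  | mod Θ Γ φ => [⟨Θ, Γ ∪ {φ}⟩]
  | mu Θ Γ x φ => [⟨Θ, Γ ∪ {φ.subst x (.mu x φ)}⟩]
  | nu Θ Γ u x φ a => [⟨Θ ++ [a], Γ ∪ {φ.subst x (.nu (u ++ [a]) x φ)}⟩]
  | reset Θ Γ a => [trim Θ (BForm.reset a '' Γ)]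
  | merge Θ Γ _ _ ξ => [trim Θ (Γ ∪ {ξ})]

/-- The substitution in the fixed-point rules is defined, the new letter of the `ν`-rule is fresh,
resets apply to covered letters, merging yields `ξ`. -/
def Side : BRaw P V → Prop
  | mu _ _ x φ => ¬ φ.erase.Bound x
  | nu Θ _ _ x φ a => ¬ φ.erase.Bound x ∧ a ∉ Θ
  | reset Θ Γ a => a ∈ Θ ∧ Covered a Γ
  | merge Θ _ φ ψ ξ => BForm.Merge Θ φ ψ ξ
  | _ => True

end BRaw

/-- Rule instances: the side conditions hold and all expressions are sequents. -/
structure BRule (P : Type u) (V : Type v) where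
  raw : BRaw P V
  side : raw.Side
  concl_wf : raw.concl.WF
  prems_wf : ∀ Δ ∈ raw.prems, Δ.WF

/-- The derivation system. -/
noncomputable def BDer (P : Type u) (V : Type v) : DerivationSystem.{max u v} where
  Seq := BSeq P V
  Rule := BRule P V
  arity R := R.raw.prems.length
  concl R := ⟨R.raw.concl, R.concl_wf⟩
  prem R i := ⟨R.raw.prems.get i, R.prems_wf _ (List.get_mem _ i)⟩

/-- The rule instance is a reset of the letter `a`. -/
def BRule.IsReset {P : Type u} {V : Type v} (a : ℕ) (R : BRule P V) : Prop :=
  ∃ Θ Γ, R.raw = .reset Θ Γ a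

/-- The path from the companion `c` to the bud `t` has an invariant: a letter `a` that occurs in
all controls along the path, always after the same prefix `θ`, and is reset on the path. -/
def HasInvariant {P : Type u} {V : Type v} (pf : Preproof (BDer P V)) (c t : List ℕ) : Prop :=
  ∃ (θ : List ℕ) (a : ℕ),
    (∀ s, c <+: s → s <+: t → (θ ++ [a]) <+: (pf.label s).raw.control) ∧
    ∃ s R, c <+: s ∧ s <+: t ∧ pf.rule s = some R ∧ R.IsReset a

/-- The boolean reset system: the proofs are the assumption-free preproofs in which the path from
each companion to each of its buds has an invariant. -/
noncomputable def RKmuB (P : Type u) (V : Type v) : CyclicProofSystem.{max u v} where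
  toDerivationSystem := BDer P V
  proofs := {pf | pf.Closed ∧ ∀ t c, pf.tree.back t = some c → HasInvariant pf c t}
  closed := fun _ h => h.1

theorem Form.erase_annot {P : Type u} {V : Type v} (φ : Form P V) : φ.annot.erase = φ := by
  induction φ <;> simp_all [Form.annot, BForm.erase]

theorem Form.annots_annot {P : Type u} {V : Type v} (φ : Form P V) :
    ∀ u ∈ φ.annot.annots, u = [] := by
  induction φ with
  | prop p => exact fun u h => h.elim
  | nprop p => exact fun u h => h.elim
  | var x => exact fun u h => h.elim
  | and φ ψ h₁ h₂ => exact fun u h => h.elim (h₁ u) (h₂ u)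
  | or φ ψ h₁ h₂ => exact fun u h => h.elim (h₁ u) (h₂ u)
  | box φ h => exact h
  | dia φ h => exact h
  | mu x φ h => exact h
  | nu x φ h₁ => exact fun u h => h.elim id (h₁ u)

/-- The sequent `ε | Γ^ε`. -/
def KSeq.start {P : Type u} {V : Type v} (Γ : KSeq P V) : BSeq P V :=
  ⟨⟨[], Form.annot '' Γ.forms⟩, List.nodup_nil, Γ.wf.1.image _, by
    rintro _ ⟨φ, hφ, rfl⟩
    refine ⟨by rw [Form.erase_annot]; exact Γ.wf.2 φ hφ, fun u hu => ?_⟩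
    rw [φ.annots_annot u hu]⟩

/-- `Γ` is provable in the boolean reset system. -/
def RKmuBProves {P : Type u} {V : Type v} (Γ : KSeq P V) : Prop :=
  (RKmuB P V).Proves Γ.start

end ModalMu

namespace ModalMu

universe u v w

open Filter

/-! ### Stacks -/

/-! The reset proof is obtained by playing a strategy along a given $K_\mu$-proof and folding the
plays into a cyclic proof. A state is a node of the $K_\mu$-proof together with an annotated sequent
over its label. A sequent is normal if no two of its formulas agree up to annotations and no letter
is covered. On other sequents the strategy merges or resets, which decreases `BSeq.measure`. On
normal ones it copies the rule of the $K_\mu$-proof, and from a bud it passes to the companion by a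
vacuous weakening. In a normal sequent each letter of the control ends some annotation and each
position carries only one, so the control is no longer than the number of $\nu$-positions
(`BSeq.Normal.length_le`). If `B` bounds these numbers, one of `0, …, B` is always fresh, and only
finitely many sequents occur.

An infinite play moves along the $K_\mu$-proof infinitely often, so it induces a branch and hence a
trace with infinitely many activated steps. The annotation at the traced position stays, decreases
with respect to `StackLt`, or is cut by a reset; activated steps decrease it. The combinatorial core
is `exists_stable_reset`. Let `q` be the longest word that is eventually a prefix of all controls,
and suppose that each of its letters is reset only finitely often. Then membership of these letters
in the tracked annotation freezes one after the other. A further decrease therefore brings in a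
letter outside `q`, and a shortest control prefix witnessing this becomes stable, contradicting
maximality. So some stable letter is reset infinitely often; as some sequent recurs infinitely
often, two occurrences of it enclose such a reset (`exists_goodRepeat`).

Cutting each play at its first good repeat leaves a tree without infinite branches, finite by
König's lemma, and the repeats become its buds (`proves_of_strategy`). -/

theorem resetWord_subset {a : ℕ} {u : List ℕ} : resetWord a u ⊆ u := by
  intro b hb
  unfold resetWord at hb
  split_ifs at hb with h
  · rcases List.mem_append.1 hb with hb | hb
    · exact (List.takeWhile_sublist _).subset hb
    · rw [List.mem_singleton.1 hb]; exact h
  · exact hb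

theorem exists_resetWord_eq {a : ℕ} {u : List ℕ} (h : a ∈ u) :
    ∃ v w, u = v ++ a :: w ∧ resetWord a u = v ++ [a] := by
  obtain ⟨v, w, rfl, hv⟩ := List.eq_append_cons_of_mem h
  refine ⟨v, w, rfl, ?_⟩
  have : (v ++ a :: w).takeWhile (fun b => decide (b ≠ a)) = v := by
    rw [List.takeWhile_append_of_pos]
    · simp
    · intro b hb
      simp only [ne_eq, decide_eq_true_eq]
      rintro rfl
      exact hv hb
  simp only [resetWord, h, if_true, this]

theorem mem_resetWord_self {a : ℕ} {u : List ℕ} (h : a ∈ u) : a ∈ resetWord a u := by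
  obtain ⟨v, w, -, e⟩ := exists_resetWord_eq h
  simp [e]

theorem resetWord_sublist (a : ℕ) (u : List ℕ) : (resetWord a u).Sublist u := by
  by_cases h : a ∈ u
  · obtain ⟨v, w, rfl, e⟩ := exists_resetWord_eq h
    rw [e]
    simp
  · simp [resetWord, h]

/-- Resetting a letter outside a prefix of the control does not change the part of a word in
that prefix. -/
theorem mem_resetWord_of_mem_prefix {Θ p u : List ℕ} {a b : ℕ} (hΘ : Θ.Nodup) (hp : p <+: Θ)
    (hu : u.Sublist Θ) (ha : a ∈ p) (hb : b ∉ p) (hau : a ∈ u) : a ∈ resetWord b u := by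
  by_cases h : b ∈ u
  · obtain ⟨v, w, rfl, e⟩ := exists_resetWord_eq h
    rw [e]
    rcases List.mem_append.1 hau with hv | hv
    · exact List.mem_append_left _ hv
    rcases List.mem_cons.1 hv with rfl | hw
    · simp
    obtain ⟨r, rfl⟩ := hp
    -- If `a` came after `b` in `u`, then it would do so in the control; as `b` lies outside the
    -- prefix `p`, so would `a`.
    have h1 : [b, a].Sublist (p ++ r) :=
      (((List.singleton_sublist.2 hw).cons_cons b).trans (List.sublist_append_right v _)).trans hu
    obtain ⟨l₁, l₂, e', h₁, h₂⟩ := List.sublist_append_iff.1 h1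
    have hl : l₁ = [] := by
      cases l₁ with
      | nil => rfl
      | cons c l =>
        have : c = b := by simpa using (congrArg List.head? e').symm
        exact absurd (h₁.subset (by simp [this])) hb
    subst hl
    have : a ∈ r := h₂.subset (by simp at e'; simp [← e'])
    exact absurd this (List.disjoint_of_nodup_append hΘ ha)
  · simpa [resetWord, h] using hau

/-- The fresh letter is the only disagreement. This is how the activated step of a $\nu$-unfolding
becomes a decrease of annotations. -/
theorem stackLt_append_singleton {Θ u : List ℕ} {a : ℕ} (ha : a ∉ Θ) (hu : u.Sublist Θ) :
    StackLt (Θ ++ [a]) (u ++ [a]) u := by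
  refine ⟨Θ, a, [], rfl, by simp, fun h => ha (hu.subset h), fun b hb => ?_⟩
  have : b ≠ a := by rintro rfl; exact ha hb
  simp [this]

/-- Since the letters of `Θ` are distinct, a subsequence is determined by its set of letters. -/
theorem eq_filter_of_sublist {Θ u : List ℕ} (hΘ : Θ.Nodup) (hu : u.Sublist Θ) :
    u = Θ.filter (fun a => decide (a ∈ u)) := by
  induction hu with
  | slnil => rfl
  | @cons l₁ l₂ a h ih =>
    rw [List.nodup_cons] at hΘ
    rw [List.filter_cons_of_neg (by simpa using fun h' => hΘ.1 (h.subset h')), ← ih hΘ.2]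
  | @cons_cons l₁ l₂ a h ih =>
    rw [List.nodup_cons] at hΘ
    rw [List.filter_cons_of_pos (by simp)]
    congr 1
    refine (ih hΘ.2).trans (List.filter_congr fun b hb => ?_)
    have : b ≠ a := by rintro rfl; exact hΘ.1 hb
    simp [this]

/-- The first letter of `Θ` on which the two words disagree decides; without one they are equal. -/
theorem stackLt_trichotomy {Θ u v : List ℕ} (hΘ : Θ.Nodup) (hu : u.Sublist Θ)
    (hv : v.Sublist Θ) : StackLt Θ u v ∨ u = v ∨ StackLt Θ v u := by
  by_cases h : ∀ a ∈ Θ, (a ∈ u ↔ a ∈ v)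
  · right; left
    rw [eq_filter_of_sublist hΘ hu, eq_filter_of_sublist hΘ hv]
    exact List.filter_congr fun a ha => by simp [h a ha]
  · push Not at h
    obtain ⟨a, ha, hne⟩ := h
    obtain ⟨b, hb⟩ := Option.isSome_iff_exists.1 ((List.find?_isSome
      (p := fun a => decide (¬ (a ∈ u ↔ a ∈ v)))).2 ⟨a, ha, by simp only [decide_eq_true_eq]; tauto⟩)
    obtain ⟨hb', s, t, e, hs⟩ := List.find?_eq_some_iff_append.1 hb
    have hs : ∀ c ∈ s, (c ∈ u ↔ c ∈ v) := by simpa using hs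
    have hb' : ¬ (b ∈ u ↔ b ∈ v) := by simpa using hb'
    by_cases hbu : b ∈ u
    · exact .inl ⟨s, b, t, e, hbu, by tauto, hs⟩
    · exact .inr (.inr ⟨s, b, t, e, by tauto, hbu, fun c hc => (hs c hc).symm⟩)

/-- Along a run with bounded controls, a tracked annotation that is infinitely often decreased
forces a stable prefix of the controls whose last letter is reset infinitely often. -/
theorem exists_stable_reset {Θ Ξ : ℕ → List ℕ} {B : ℕ} (hB : ∀ i, (Θ i).length ≤ B)
    (hpre : ∀ i, Θ i <+: Ξ i) (hnd : ∀ i, (Ξ i).Nodup) (hsub : ∀ i, (Θ (i + 1)).Sublist (Ξ i))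
    {Res : ℕ → ℕ → Prop} {u : ℕ → List ℕ} (hu : ∀ᶠ i in atTop, (u i).Sublist (Θ i))
    (hstep : ∀ᶠ i in atTop, u (i + 1) = u i ∨ StackLt (Ξ i) (u (i + 1)) (u i) ∨
      ∃ b, Res i b ∧ u (i + 1) = resetWord b (u i))
    (hact : ∃ᶠ i in atTop, StackLt (Ξ i) (u (i + 1)) (u i)) :
    ∃ θ a, (∀ᶠ i in atTop, θ ++ [a] <+: Θ i) ∧ ∃ᶠ i in atTop, Res i a := by
  by_contra hcon
  push Not at hcon
  -- a longest eventual prefix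
  obtain ⟨q, hq, hmax⟩ : ∃ q : List ℕ, (∀ᶠ i in atTop, q <+: Θ i) ∧
      ∀ p : List ℕ, (∀ᶠ i in atTop, p <+: Θ i) → p.length ≤ q.length := by
    have hex : ∃ n, ∃ q : List ℕ, (∀ᶠ i in atTop, q <+: Θ i) ∧ B - q.length = n :=
      ⟨_, [], by simp, rfl⟩
    classical
    obtain ⟨q, hq, e⟩ := Nat.find_spec hex
    refine ⟨q, hq, fun p hp => ?_⟩
    have h1 := Nat.find_min' hex ⟨p, hp, rfl⟩
    obtain ⟨i, hi⟩ := (hp.and hq).exists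
    have := hi.1.length_le
    have := hi.2.length_le
    have := hB i
    omega
  -- Each letter of `q` ends a stable prefix, so the assumption for contradiction bounds its resets.
  have hres : ∀ᶠ i in atTop, ∀ a ∈ q, ¬ Res i a := by
    have : ∀ a ∈ q.toFinset, ∀ᶠ i in atTop, ¬ Res i a := by
      intro a ha
      obtain ⟨θ, r, e⟩ := List.append_of_mem (List.mem_toFinset.1 ha)
      have := hcon θ a (hq.mono fun i hi => (List.IsPrefix.trans ⟨r, by simp [e]⟩ hi))
      simpa using this
    have := (Finset.eventually_all q.toFinset).2 this
    filter_upwards [this] with i hi a ha using hi a (List.mem_toFinset.2 ha)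
  have hqΞ : ∀ᶠ i in atTop, q <+: Ξ i := hq.mono fun i hi => hi.trans (hpre i)
  -- membership of the letters of `q` stabilises
  have hstab : ∀ p : List ℕ, p <+: q → ∀ᶠ i in atTop, ∀ a ∈ p, (a ∈ u (i + 1) ↔ a ∈ u i) := by
    intro p
    induction p using List.reverseRecOn with
    | nil => simp
    | append_singleton p a ih =>
      intro hp
      have ih := ih ((List.prefix_append p [a]).trans hp)
      -- Once in the annotation, `a` stays. The deciding letter of a decrease is new, hence outside
      -- `p`, so `a` precedes it or equals it; resets of letters outside `q` do not affect letters
      -- of `q`.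
      have hmono : ∀ᶠ i in atTop, a ∈ u i → a ∈ u (i + 1) := by
        filter_upwards [ih, hqΞ, hq, hres, hstep, hu] with i hi hqi hqi' hri hsi hui hau
        rcases hsi with h | ⟨s, b, t, e, hb, hb', hs⟩ | ⟨b, hb, h⟩
        · rwa [h]
        · have hbp : b ∉ p := fun h => hb' ((hi b h).1 hb)
          have h1 : p ++ [a] <+: Ξ i := hp.trans hqi
          have h2 : s ++ [b] <+: Ξ i := ⟨t, by simp [e]⟩
          rcases List.prefix_or_prefix_of_prefix h1 h2 with h | h
          · have ha : a ∈ s ++ [b] := h.subset (by simp)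
            rcases List.mem_append.1 ha with ha | ha
            · exact (hs a ha).2 hau
            · rwa [List.mem_singleton.1 ha]
          · have ha : b ∈ p ++ [a] := h.subset (by simp)
            rcases List.mem_append.1 ha with ha | ha
            · exact absurd ha hbp
            · rwa [← List.mem_singleton.1 ha]
        · rw [h]
          refine mem_resetWord_of_mem_prefix ((hnd i).sublist (hpre i).sublist) hqi' hui
            (hp.subset (by simp)) (fun h => hri b h hb) hau
      have : ∀ᶠ i in atTop, (a ∈ u (i + 1) ↔ a ∈ u i) := by
        by_cases hf : ∃ᶠ i in atTop, a ∈ u i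
        · obtain ⟨N, hN⟩ := eventually_atTop.1 hmono
          obtain ⟨M, hM, hau⟩ := frequently_atTop.1 hf N
          have hall : ∀ i ≥ M, a ∈ u i := by
            intro i hi
            induction i, hi using Nat.le_induction with
            | base => exact hau
            | succ i hi ih => exact hN i (hM.trans hi) ih
          filter_upwards [eventually_ge_atTop M] with i hi
          exact iff_of_true (hall _ (by omega)) (hall _ hi)
        · obtain ⟨N, hN⟩ := eventually_atTop.1 (not_frequently.1 hf)
          filter_upwards [eventually_ge_atTop N] with i hi
          exact iff_of_false (hN _ (by omega)) (hN _ hi)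
      filter_upwards [ih, this] with i h1 h2 b hb
      rcases List.mem_append.1 hb with hb | hb
      · exact h1 b hb
      · rwa [List.mem_singleton.1 hb]
  -- collect everything from some point on
  obtain ⟨N, hN⟩ := eventually_atTop.1
    ((hstab q List.prefix_rfl).and (hres.and (hq.and (hstep.and hu))))
  -- Such a `p` witnesses that the annotation reaches beyond `q`. It persists up to deletion of
  -- letters, so a shortest one never changes again and is a stable prefix longer than `q`.
  let Q : ℕ → List ℕ → Prop := fun i p => q <+: p ∧ p <+: Θ i ∧ ∃ d ∈ p, d ∉ q ∧ d ∈ u i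
  have hQ : ∀ i ≥ N, ∀ p, Q i p → ∃ p', Q (i + 1) p' ∧ p'.Sublist p := by
    rintro i hi p ⟨hqp, hp, d, hdp, hdq, hdu⟩
    obtain ⟨h1, h2, h3, h4, h5⟩ := hN i hi
    obtain ⟨h1', h2', h3', h4', h5'⟩ := hN (i + 1) (by omega)
    -- A decrease keeps `d` or brings in its deciding letter within `p`. A reset inside `p` keeps
    -- the reset letter itself, and one outside `p` keeps `d`.
    obtain ⟨d', hd'p, hd'q, hd'u⟩ : ∃ d ∈ p, d ∉ q ∧ d ∈ u (i + 1) := by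
      rcases h4 with h | ⟨s, b, t, e, hb, hb', hs⟩ | ⟨b, hb, h⟩
      · exact ⟨d, hdp, hdq, h ▸ hdu⟩
      · have hbq : b ∉ q := fun h => hb' ((h1 b h).1 hb)
        rcases List.prefix_or_prefix_of_prefix (hp.trans (hpre i))
          (show s ++ [b] <+: Ξ i from ⟨t, by simp [e]⟩) with h | h
        · rcases List.mem_append.1 (h.subset hdp) with hd | hd
          · exact ⟨d, hdp, hdq, (hs d hd).2 hdu⟩
          · exact ⟨d, hdp, hdq, (List.mem_singleton.1 hd) ▸ hb⟩
        · exact ⟨b, h.subset (by simp), hbq, hb⟩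
      · have hbq : b ∉ q := fun h => h2 b h hb
        rw [h]
        by_cases hbp : b ∈ p
        · by_cases hbu : b ∈ u i
          · exact ⟨b, hbp, hbq, mem_resetWord_self hbu⟩
          · exact ⟨d, hdp, hdq, by simpa [resetWord, hbu] using hdu⟩
        · exact ⟨d, hdp, hdq, mem_resetWord_of_mem_prefix
            ((hnd i).sublist (hpre i).sublist) hp h5 hdp hbp hdu⟩
    -- The next control is a subsequence of `p ++ r`, so it splits into remainders of `p` and of
    -- `r`; distinctness of letters puts `d'` into the former.
    obtain ⟨r, hr⟩ := hp.trans (hpre i)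
    have h6 := hsub i
    rw [← hr] at h6
    obtain ⟨p₁, r₁, e, hp₁, hr₁⟩ := List.sublist_append_iff.1 h6
    have hnd' := hnd i
    rw [← hr] at hnd'
    have hd'p₁ : d' ∈ p₁ := by
      have : d' ∈ p₁ ++ r₁ := e ▸ h5'.subset hd'u
      rcases List.mem_append.1 this with h | h
      · exact h
      · exact absurd (hr₁.subset h) (List.disjoint_of_nodup_append hnd' hd'p)
    have hpp : p₁ <+: Θ (i + 1) := ⟨r₁, e.symm⟩
    refine ⟨p₁, ⟨?_, hpp, d', hd'p₁, hd'q, hd'u⟩, hp₁⟩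
    rcases List.prefix_or_prefix_of_prefix h3' hpp with h | h
    · exact h
    · exact absurd (h.subset hd'p₁) hd'q
  -- A decrease after `N` starts the process: its deciding letter is new, hence outside `q`, and the
  -- whole control serves as `p`.
  have hex : ∃ n, ∃ i ≥ N, ∃ p, Q i p ∧ p.length = n := by
    obtain ⟨i, hi, s, b, t, e, hb, hb', hs⟩ := frequently_atTop.1 hact N
    obtain ⟨h1, h2, h3, h4, h5⟩ := hN i hi
    obtain ⟨h1', h2', h3', h4', h5'⟩ := hN (i + 1) (by omega)
    exact ⟨_, i + 1, by omega, Θ (i + 1), ⟨h3', List.prefix_rfl, b, h5'.subset hb,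
      fun h => hb' ((h1 b h).1 hb), hb⟩, rfl⟩
  classical
  obtain ⟨i, hi, p, hp, hlen⟩ := Nat.find_spec hex
  have hall : ∀ j ≥ i, Q j p := by
    intro j hj
    induction j, hj using Nat.le_induction with
    | base => exact hp
    | succ j hj ih =>
      obtain ⟨p', hp', hs⟩ := hQ j (hi.trans hj) p ih
      have := Nat.find_min' hex ⟨j + 1, by omega, p', hp', rfl⟩
      rwa [← hs.eq_of_length (le_antisymm hs.length_le (by omega))]
  have h1 := hmax p (eventually_atTop.2 ⟨i, fun j hj => (hall j hj).2.1⟩)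
  obtain ⟨hqp, -, d, hd, hdq, -⟩ := hp
  rw [hqp.eq_of_length (le_antisymm hqp.length_le h1)] at hdq
  exact hdq hd

/-! ### Cyclic proofs from strategies -/

theorem exists_chain {α : Type*} {p : ℕ → α → Prop} {r : ℕ → α → α → Prop} (a : α) (ha : p 0 a)
    (h : ∀ n a, p n a → ∃ b, p (n + 1) b ∧ r n a b) :
    ∃ f : ℕ → α, f 0 = a ∧ ∀ n, p n (f n) ∧ r n (f n) (f (n + 1)) := by
  classical
  choose g hg hr using h
  let F : (n : ℕ) → {a // p n a} := fun n =>
    Nat.rec ⟨a, ha⟩ (fun n x => ⟨g n x.1 x.2, hg n x.1 x.2⟩) n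
  exact ⟨fun n => (F n).1, rfl, fun n => ⟨(F n).2, hr n _ _⟩⟩

/-- A finitely branching prefix-closed set of words without infinite branches is finite. -/
theorem finite_of_no_branch {T : Set (List ℕ)}
    (hT : ∀ ⦃s t : List ℕ⦄, s <+: t → t ∈ T → s ∈ T) (b : List ℕ → ℕ)
    (hb : ∀ t i, t ++ [i] ∈ T → i < b t)
    (h : ∀ f : ℕ → List ℕ, f 0 = [] → (∀ n, f n ∈ T) → ¬ ∀ n, ∃ i, f (n + 1) = f n ++ [i]) :
    T.Finite := by
  by_contra hinf
  let S : List ℕ → Set (List ℕ) := fun t => {s | s ∈ T ∧ t <+: s}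
  have hstep : ∀ t, ¬ (S t).Finite → ∃ i, ¬ (S (t ++ [i])).Finite := by
    intro t ht
    by_contra hcon
    push Not at hcon
    refine ht (((Set.finite_singleton t).union
      ((Set.finite_lt_nat (b t)).biUnion fun i _ => hcon i)).subset ?_)
    rintro s ⟨hs, r, rfl⟩
    cases r with
    | nil => simp
    | cons i r =>
      have hpre : t ++ [i] <+: t ++ i :: r := ⟨r, by simp⟩
      exact Or.inr (Set.mem_biUnion (hb t i (hT hpre hs)) ⟨hs, hpre⟩)
  obtain ⟨f, h0, hf⟩ := exists_chain (p := fun _ t => ¬ (S t).Finite)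
    (r := fun _ t t' => ∃ i, t' = t ++ [i]) [] (by simpa [S] using hinf)
    (fun _ t ht => (hstep t ht).elim fun i hi => ⟨_, hi, i, rfl⟩)
  refine h f h0 (fun n => ?_) fun n => (hf n).2
  have hne : (S (f n)).Nonempty := by
    by_contra he
    rw [Set.not_nonempty_iff_eq_empty] at he
    exact (hf n).1 (he ▸ Set.finite_empty)
  obtain ⟨s, hs, hp⟩ := hne
  exact hT hp hs

/-- Between the times `m < n`, some letter is kept with its prefix and reset. -/
def GoodRepeat {P : Type u} {V : Type v} (lab : ℕ → BSeq P V) (rl : ℕ → BRule P V)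
    (m n : ℕ) : Prop :=
  lab m = lab n ∧ ∃ (θ : List ℕ) (a : ℕ),
    (∀ k, m ≤ k → k ≤ n → (θ ++ [a]) <+: (lab k).raw.control) ∧
    ∃ k, m ≤ k ∧ k < n ∧ (rl k).IsReset a

/-- A strategy all of whose infinite plays contain a good repeat yields a cyclic proof. -/
theorem proves_of_strategy {P : Type u} {V : Type v} {σ : Type w} (lab : σ → BSeq P V)
    (rl : σ → BRule P V) (nx : σ → ℕ → σ) (hconcl : ∀ s, lab s = (BDer P V).concl (rl s))
    (hprem : ∀ s (i : Fin ((BDer P V).arity (rl s))), lab (nx s i) = (BDer P V).prem (rl s) i)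
    (s₀ : σ)
    (h : ∀ f : ℕ → σ, f 0 = s₀ →
      (∀ n, ∃ i < (BDer P V).arity (rl (f n)), f (n + 1) = nx (f n) i) →
      ∃ m n, m < n ∧ GoodRepeat (lab ∘ f) (rl ∘ f) m n) :
    (RKmuB P V).Proves (lab s₀) := by
  classical
  let st : List ℕ → σ := fun t => t.foldl nx s₀
  have st_snoc : ∀ t i, st (t ++ [i]) = nx (st t) i := fun t i => by simp [st]
  -- The reset has to take place strictly before `t`, because a bud carries no rule.
  let Rep : List ℕ → List ℕ → Prop := fun c t => c <+: t ∧ c ≠ t ∧ lab (st c) = lab (st t) ∧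
    ∃ (θ : List ℕ) (a : ℕ), (∀ s, c <+: s → s <+: t → (θ ++ [a]) <+: (lab (st s)).raw.control) ∧
      ∃ s, c <+: s ∧ s <+: t ∧ s ≠ t ∧ (rl (st s)).IsReset a
  -- Only proper prefixes must be free of repeats, so a word closing a repeat stays in the tree as a
  -- leaf.
  let T : Set (List ℕ) := {t | (∀ s i, s ++ [i] <+: t → i < (BDer P V).arity (rl (st s))) ∧
    ∀ s, s <+: t → s ≠ t → ¬ ∃ c, Rep c s}
  have hT : ∀ ⦃s t : List ℕ⦄, s <+: t → t ∈ T → s ∈ T := by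
    rintro s t hst ⟨h1, h2⟩
    refine ⟨fun r i hr => h1 r i (hr.trans hst), fun r hr hne => h2 r (hr.trans hst) ?_⟩
    rintro rfl
    exact hne (hr.eq_of_length (le_antisymm hr.length_le hst.length_le))
  have hchild : ∀ t i, t ∈ T → (t ++ [i] ∈ T ↔
      i < (BDer P V).arity (rl (st t)) ∧ ¬ ∃ c, Rep c t) := by
    intro t i ht
    constructor
    · rintro ⟨h1, h2⟩
      exact ⟨h1 t i List.prefix_rfl, h2 t (List.prefix_append _ _) (by simp)⟩
    · rintro ⟨h1, h2⟩
      refine ⟨fun s j hs => ?_, fun s hs hne => ?_⟩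
      · rcases List.prefix_concat_iff.1 hs with e | hs
        · obtain ⟨rfl, e'⟩ := List.append_inj' e rfl
          obtain rfl : j = i := by simpa using e'
          exact h1
        · exact ht.1 s j hs
      · rcases List.prefix_concat_iff.1 hs with e | hs
        · exact absurd e hne
        · by_cases e : s = t
          · rwa [e]
          · exact ht.2 s hs e
  have hfin : T.Finite := by
    refine finite_of_no_branch hT (fun t => (BDer P V).arity (rl (st t)))
      (fun t i ht => ((hchild t i (hT (List.prefix_append _ _) ht)).1 ht).1) ?_
    intro f h0 hfT hf
    have hlen : ∀ n, (f n).length = n := by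
      intro n
      induction n with
      | zero => simp [h0]
      | succ n ih => obtain ⟨i, hi⟩ := hf n; simp [hi, ih]
    have hmono : ∀ {m n}, m ≤ n → f m <+: f n := by
      intro m n hmn
      induction n, hmn using Nat.le_induction with
      | base => exact List.prefix_rfl
      | succ n _ ih => obtain ⟨i, hi⟩ := hf n; exact ih.trans ⟨[i], hi.symm⟩
    have hpre : ∀ {s n}, s <+: f n → s = f s.length := by
      intro s n hs
      have hl := hs.length_le
      rw [hlen] at hl
      exact (List.prefix_of_prefix_length_le hs (hmono hl) (by rw [hlen])).eq_of_length
        (by rw [hlen])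
    obtain ⟨m, n, hmn, e, θ, a, h1, k, hmk, hkn, h2⟩ := h (fun n => st (f n)) (by simp [h0, st])
      (fun n => by
        obtain ⟨i, hi⟩ := hf n
        refine ⟨i, ((hchild (f n) i (hfT n)).1 (hi ▸ hfT (n + 1))).1, ?_⟩
        simp only [hi, st_snoc])
    -- `f n` closes a repeat, so its child `f (n + 1)` should have been cut off.
    refine (hfT (n + 1)).2 (f n) (hmono (by omega)) (fun h' => ?_) ⟨f m, hmono hmn.le,
      fun h' => ?_, e, θ, a, fun s hs hs' => ?_, f k, hmono hmk, hmono hkn.le, fun h' => ?_, h2⟩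
    · have := congrArg List.length h'; simp only [hlen] at this; omega
    · have := congrArg List.length h'; simp only [hlen] at this; omega
    · rw [hpre hs']
      have := hs.length_le
      have := hs'.length_le
      rw [hlen] at *
      exact h1 _ (by omega) (by omega)
    · have := congrArg List.length h'; simp only [hlen] at this; omega
  let bk : List ℕ → Option (List ℕ) := fun t =>
    if h : t ∈ T ∧ ∃ c, Rep c t then some h.2.choose else none
  have hbk : ∀ {t c}, bk t = some c → t ∈ T ∧ Rep c t := by
    intro t c h
    by_cases h' : t ∈ T ∧ ∃ c, Rep c t
    · simp only [bk, h', and_self, dif_pos, Option.some.injEq] at h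
      exact ⟨h'.1, h ▸ h'.2.choose_spec⟩
    · simp only [bk] at h
      rw [dif_neg h'] at h
      cases h
  have hbk_none : ∀ {t}, bk t = none ↔ ¬ (t ∈ T ∧ ∃ c, Rep c t) := by
    intro t
    by_cases h' : t ∈ T ∧ ∃ c, Rep c t
    · simp only [bk]; rw [dif_pos h']; simp [h']
    · simp only [bk]; rw [dif_neg h']; simp only [h', not_false_eq_true]
  have hbk_of_child : ∀ {t i}, t ++ [i] ∈ T → bk t = none := by
    intro t i ht
    exact hbk_none.2 fun h' => ((hchild t i h'.1).1 ht).2 h'.2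
  let C : CyclicTree :=
    { nodes := T
      finite := hfin
      nonempty := ⟨[], by simp, by simp⟩
      prefix_closed := hT
      back := bk
      back_leaf := fun t c h' => ⟨(hbk h').1, fun i hi => by
        have := hbk_of_child hi; rw [this] at h'; cases h'⟩
      back_inner := fun t c h' => by
        obtain ⟨ht, ⟨r, rfl⟩, hne, -⟩ := hbk h'
        cases r with
        | nil => simp at hne
        | cons i r => exact ⟨hT (List.prefix_append _ _) ht, i, hT ⟨r, by simp⟩ ht⟩
      back_lt := fun t c h' => ⟨(hbk h').2.1, (hbk h').2.2.1⟩ }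
  let ru : List ℕ → Option (BRule P V) := fun t =>
    if t ∈ T ∧ ¬ ∃ c, Rep c t then some (rl (st t)) else none
  have hru : ∀ {t R}, ru t = some R → t ∈ T ∧ (¬ ∃ c, Rep c t) ∧ R = rl (st t) := by
    intro t R h'
    by_cases h'' : t ∈ T ∧ ¬ ∃ c, Rep c t
    · simp only [ru] at h'
      rw [if_pos h''] at h'
      exact ⟨h''.1, h''.2, (Option.some.inj h').symm⟩
    · simp only [ru] at h'
      rw [if_neg h''] at h'
      cases h'
  have hru_some : ∀ {t}, t ∈ T → (¬ ∃ c, Rep c t) → ru t = some (rl (st t)) := by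
    intro t h1 h2
    simp only [ru]
    rw [if_pos ⟨h1, h2⟩]
  let pf : Preproof (BDer P V) :=
    { tree := C
      label := fun t => lab (st t)
      rule := ru
      label_back := fun t c h' => (hbk h').2.2.2.1.symm
      rule_node := fun t R h' => ⟨(hru h').1, hbk_none.2 fun h'' => (hru h').2.1 h''.2⟩
      rule_concl := fun t R h' => by rw [(hru h').2.2]; exact hconcl _
      rule_children := fun t R h' i => by
        obtain ⟨h1, h2, rfl⟩ := hru h'
        exact (hchild t i h1).trans (and_iff_left h2)
      rule_prem := fun t R h' i => by
        obtain ⟨h1, h2, rfl⟩ := hru h'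
        rw [st_snoc]
        exact hprem _ i
      leaf_of_no_rule := fun t h1 h2 h3 => by
        rw [hru_some h1 fun h' => hbk_none.1 h2 ⟨h1, h'⟩] at h3
        cases h3 }
  refine ⟨pf, ⟨fun t ht h' => ⟨_, hru_some ht.1 fun h'' => hbk_none.1 h' ⟨ht.1, h''⟩⟩, ?_⟩, rfl⟩
  intro t c h'
  obtain ⟨ht, -, -, -, θ, a, h1, s, hcs, hst, hne, hr⟩ := hbk h'
  exact ⟨θ, a, h1, s, _, hcs, hst, hru_some (hT hst ht) (ht.2 s hst hne), hr⟩

/-! ### Annotations of formulas -/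

namespace BForm

variable {P : Type u} {V : Type v}

/-- The annotation of the greatest fixed-point quantifier at an address. -/
def annotAt : BForm P V → List Bool → Option (List ℕ)
  | prop _, _ => none
  | nprop _, _ => none
  | var _, _ => none
  | and φ _, false :: a => annotAt φ a
  | and _ ψ, true :: a => annotAt ψ a
  | and _ _, [] => none
  | or φ _, false :: a => annotAt φ a
  | or _ ψ, true :: a => annotAt ψ a
  | or _ _, [] => none
  | box φ, false :: a => annotAt φ a
  | box _, _ => none
  | dia φ, false :: a => annotAt φ a
  | dia _, _ => none
  | mu _ φ, false :: a => annotAt φ a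
  | mu _ _, _ => none
  | nu u _ _, [] => some u
  | nu _ _ φ, false :: a => annotAt φ a
  | nu _ _ _, true :: _ => none

theorem mem_annots_of_annotAt {φ : BForm P V} {a : List Bool} {u : List ℕ}
    (h : φ.annotAt a = some u) : u ∈ φ.annots := by
  induction φ generalizing a <;> rcases a with _ | ⟨_ | _, a⟩ <;>
    simp_all [annotAt, annots]
  all_goals grind

theorem exists_annotAt {φ : BForm P V} {u : List ℕ} (h : u ∈ φ.annots) :
    ∃ a, φ.annotAt a = some u := by
  induction φ with
  | prop | nprop | var => exact h.elim
  | and φ ψ h₁ h₂ | or φ ψ h₁ h₂ =>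
    rcases h with h | h
    · obtain ⟨a, ha⟩ := h₁ h; exact ⟨false :: a, ha⟩
    · obtain ⟨a, ha⟩ := h₂ h; exact ⟨true :: a, ha⟩
  | box φ h₁ | dia φ h₁ | mu _ φ h₁ =>
    obtain ⟨a, ha⟩ := h₁ h; exact ⟨false :: a, ha⟩
  | nu v x φ h₁ =>
    rcases h with h | h
    · obtain rfl : u = v := h
      exact ⟨[], rfl⟩
    · obtain ⟨a, ha⟩ := h₁ h; exact ⟨false :: a, ha⟩

/-- This allows a trace, which sees unannotated formulas only, to be read as a sequence of
annotations. -/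
theorem mem_nuAddr_erase_iff {φ : BForm P V} {a : List Bool} :
    a ∈ φ.erase.nuAddr ↔ ∃ u, φ.annotAt a = some u := by
  induction φ generalizing a <;> rcases a with _ | ⟨_ | _, a⟩ <;>
    simp_all [annotAt, erase, Form.nuAddr, Form.at?]
  all_goals cases a <;> simp

theorem erase_subst (φ : BForm P V) (x : V) (χ : BForm P V) :
    (φ.subst x χ).erase = φ.erase.subst x χ.erase := by
  induction φ with
  | var y => by_cases h : y = x <;> simp [subst, Form.subst, erase, h]
  | _ => simp_all [subst, Form.subst, erase]

theorem annotAt_subst {φ : BForm P V} {x : V} {χ : BForm P V} {a : List Bool} {u : List ℕ}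
    (h : φ.annotAt a = some u) : (φ.subst x χ).annotAt a = some u := by
  induction φ generalizing a <;> rcases a with _ | ⟨_ | _, a⟩ <;>
    simp_all [annotAt, subst]

theorem annotAt_subst_append {φ : BForm P V} {x : V} {χ : BForm P V} {a b : List Bool}
    (h : φ.erase.at? a = some (.var x)) : (φ.subst x χ).annotAt (a ++ b) = χ.annotAt b := by
  induction φ generalizing a <;> rcases a with _ | ⟨_ | _, a⟩ <;>
    simp_all [annotAt, subst, erase, Form.at?]
  all_goals cases a <;> simp_all

theorem annots_subst {φ : BForm P V} {x : V} {χ : BForm P V} :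
    (φ.subst x χ).annots ⊆ φ.annots ∪ χ.annots := by
  induction φ with
  | var y => by_cases h : y = x <;> simp [subst, annots, h]
  | and _ _ h₁ h₂ | or _ _ h₁ h₂ => simp only [subst, annots]; grind
  | nu _ _ _ h => simp only [subst, annots]; grind
  | _ => simp_all [subst, annots]

theorem erase_reset (a : ℕ) (φ : BForm P V) : (reset a φ).erase = φ.erase := by
  induction φ <;> simp_all [reset, erase]

theorem annotAt_reset (a : ℕ) (φ : BForm P V) (b : List Bool) :
    (reset a φ).annotAt b = (φ.annotAt b).map (resetWord a) := by
  induction φ generalizing b <;> rcases b with _ | ⟨_ | _, b⟩ <;>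
    simp_all [annotAt, reset]

theorem exists_of_mem_annots_reset {a : ℕ} {φ : BForm P V} {u : List ℕ}
    (h : u ∈ (reset a φ).annots) : ∃ v ∈ φ.annots, u = resetWord a v := by
  obtain ⟨b, hb⟩ := exists_annotAt h
  rw [annotAt_reset, Option.map_eq_some_iff] at hb
  obtain ⟨v, hv, rfl⟩ := hb
  exact ⟨v, mem_annots_of_annotAt hv, rfl⟩

/-- The total length of the annotations. -/
def weight : BForm P V → ℕ
  | prop _ => 0
  | nprop _ => 0
  | var _ => 0
  | and φ ψ => weight φ + weight ψ
  | or φ ψ => weight φ + weight ψ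
  | box φ => weight φ
  | dia φ => weight φ
  | mu _ φ => weight φ
  | nu u _ φ => u.length + weight φ

theorem weight_reset_le (a : ℕ) (φ : BForm P V) : (reset a φ).weight ≤ φ.weight := by
  induction φ with
  | nu u x φ ih =>
    have := (resetWord_sublist a u).length_le
    simp only [reset, weight]; omega
  | prop | nprop | var => exact le_rfl
  | _ => simp only [reset, weight]; omega

/-- A word that contains `a` without ending in it loses a letter when cut after `a`. -/
theorem weight_reset_lt {a : ℕ} {φ : BForm P V} {u : List ℕ} (hu : u ∈ φ.annots) (ha : a ∈ u)
    (hlast : u.getLast? ≠ some a) : (reset a φ).weight < φ.weight := by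
  induction φ with
  | prop | nprop | var => exact hu.elim
  | and φ ψ h₁ h₂ | or φ ψ h₁ h₂ =>
    have := weight_reset_le a φ
    have := weight_reset_le a ψ
    rcases hu with h | h
    · have := h₁ h; simp only [reset, weight]; omega
    · have := h₂ h; simp only [reset, weight]; omega
  | box φ h₁ | dia φ h₁ | mu _ φ h₁ => exact h₁ hu
  | nu v x φ h₁ =>
    have h3 := (resetWord_sublist a v).length_le
    have := weight_reset_le a φ
    rcases hu with h | h
    · obtain rfl : u = v := h
      obtain ⟨s, t, e, e'⟩ := exists_resetWord_eq ha
      have : (resetWord a u).length ≠ u.length := by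
        intro hl
        have := (resetWord_sublist a u).eq_of_length hl
        apply hlast
        rw [← this, e']
        simp
      simp only [reset, weight]; omega
    · have := h₁ h; simp only [reset, weight]; omega

theorem exists_merge {Θ : List ℕ} {φ ψ : BForm P V} (h : φ.erase = ψ.erase)
    (hφ : ∀ u ∈ φ.annots, u.Sublist Θ) (hψ : ∀ u ∈ ψ.annots, u.Sublist Θ) :
    ∃ ξ, Merge Θ φ ψ ξ := by
  induction φ generalizing ψ <;> cases ψ <;> simp only [erase] at h <;> try contradiction
  case prop.prop => cases h; exact ⟨_, .prop _⟩
  case nprop.nprop => cases h; exact ⟨_, .nprop _⟩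
  case var.var => cases h; exact ⟨_, .var _⟩
  case and.and h₁ h₂ _ _ =>
    injection h with e₁ e₂
    obtain ⟨_, m₁⟩ := h₁ e₁ (fun u hu => hφ u (.inl hu)) (fun u hu => hψ u (.inl hu))
    obtain ⟨_, m₂⟩ := h₂ e₂ (fun u hu => hφ u (.inr hu)) (fun u hu => hψ u (.inr hu))
    exact ⟨_, .and m₁ m₂⟩
  case or.or h₁ h₂ _ _ =>
    injection h with e₁ e₂
    obtain ⟨_, m₁⟩ := h₁ e₁ (fun u hu => hφ u (.inl hu)) (fun u hu => hψ u (.inl hu))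
    obtain ⟨_, m₂⟩ := h₂ e₂ (fun u hu => hφ u (.inr hu)) (fun u hu => hψ u (.inr hu))
    exact ⟨_, .or m₁ m₂⟩
  case box.box h₁ _ =>
    injection h with e₁
    obtain ⟨_, m₁⟩ := h₁ e₁ hφ hψ
    exact ⟨_, .box m₁⟩
  case dia.dia h₁ _ =>
    injection h with e₁
    obtain ⟨_, m₁⟩ := h₁ e₁ hφ hψ
    exact ⟨_, .dia m₁⟩
  case mu.mu h₁ _ _ =>
    injection h with e₀ e₁
    subst e₀
    obtain ⟨_, m₁⟩ := h₁ e₁ hφ hψ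
    exact ⟨_, .mu _ m₁⟩
  case nu.nu h₁ _ _ _ =>
    injection h with e₀ e₁
    subst e₀
    obtain ⟨_, m₁⟩ := h₁ e₁ (fun u hu => hφ u (.inr hu)) (fun u hu => hψ u (.inr hu))
    exact ⟨_, .nu _ _ _ (hφ _ (.inl rfl)) (hψ _ (.inl rfl)) m₁⟩

namespace Merge

variable {Θ : List ℕ} {φ ψ ξ : BForm P V}

theorem erase_left (h : Merge Θ φ ψ ξ) : ξ.erase = φ.erase := by
  induction h <;> simp_all [erase]

/-- Merging is pointwise, so a trace through either formula continues in the merged one with an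
annotation that is no larger. -/
theorem annotAt_cases (h : Merge Θ φ ψ ξ) (a : List Bool) :
    (φ.annotAt a = none ∧ ψ.annotAt a = none ∧ ξ.annotAt a = none) ∨
    ∃ u v, φ.annotAt a = some u ∧ ψ.annotAt a = some v ∧ u.Sublist Θ ∧ v.Sublist Θ ∧
      ξ.annotAt a = some (stackMin Θ u v) := by
  induction h generalizing a <;> rcases a with _ | ⟨_ | _, a⟩ <;> simp_all [annotAt]

theorem weight_le (h : Merge Θ φ ψ ξ) : ξ.weight ≤ φ.weight + ψ.weight := by
  induction h with
  | nu u v x _ _ _ ih =>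
    have : (stackMin Θ u v).length ≤ u.length + v.length := by
      unfold stackMin; split_ifs <;> omega
    simp only [weight]; omega
  | _ => simp only [weight] at *; omega

theorem annots_subset (h : Merge Θ φ ψ ξ) : ξ.annots ⊆ φ.annots ∪ ψ.annots := by
  intro w hw
  obtain ⟨a, ha⟩ := exists_annotAt hw
  rcases h.annotAt_cases a with ⟨-, -, h⟩ | ⟨u, v, hu, hv, -, -, h⟩
  · rw [h] at ha; cases ha
  · rw [h] at ha
    cases ha
    unfold stackMin
    split_ifs
    · exact .inl (mem_annots_of_annotAt hu)
    · exact .inr (mem_annots_of_annotAt hv)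

end Merge

/-- An annotated version of `ψ` amounts to the choice of a word from `W` at each $\nu$-quantifier.
-/
theorem finite_of_erase_eq {W : Set (List ℕ)} (hW : W.Finite) (ψ : Form P V) :
    {φ : BForm P V | φ.erase = ψ ∧ φ.annots ⊆ W}.Finite := by
  induction ψ with
  | prop p =>
    refine (Set.finite_singleton (prop p)).subset ?_
    rintro (_ | _) ⟨h, -⟩ <;> simp_all [erase]
  | nprop p =>
    refine (Set.finite_singleton (nprop p)).subset ?_
    rintro (_ | _) ⟨h, -⟩ <;> simp_all [erase]
  | var p =>
    refine (Set.finite_singleton (var p)).subset ?_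
    rintro (_ | _) ⟨h, -⟩ <;> simp_all [erase]
  | and _ _ h₁ h₂ =>
    refine (Set.Finite.image2 and h₁ h₂).subset ?_
    rintro (_ | _) ⟨h, h'⟩ <;> simp_all [erase, annots, Set.union_subset_iff]
  | or _ _ h₁ h₂ =>
    refine (Set.Finite.image2 or h₁ h₂).subset ?_
    rintro (_ | _) ⟨h, h'⟩ <;> simp_all [erase, annots, Set.union_subset_iff]
  | box _ h₁ =>
    refine (h₁.image box).subset ?_
    rintro (_ | _) ⟨h, h'⟩ <;> simp_all [erase, annots]
  | dia _ h₁ =>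
    refine (h₁.image dia).subset ?_
    rintro (_ | _) ⟨h, h'⟩ <;> simp_all [erase, annots]
  | mu x _ h₁ =>
    refine (h₁.image (mu x)).subset ?_
    rintro (_ | _) ⟨h, h'⟩ <;> simp_all [erase, annots]
  | nu x _ h₁ =>
    refine (Set.Finite.image2 (fun u φ => nu u x φ) hW h₁).subset ?_
    rintro (_ | _) ⟨h, h'⟩ <;> simp_all [erase, annots, Set.insert_subset_iff]

end BForm

/-! ### Finiteness of the set of bounded sequents -/

theorem finite_nodup_bounded (n : ℕ) : {l : List ℕ | l.Nodup ∧ ∀ a ∈ l, a < n}.Finite := by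
  -- By the pigeonhole principle these words over `Fin n` have length at most `n`.
  refine ((List.finite_length_le (Fin n) n).image (List.map Fin.val)).subset ?_
  rintro l ⟨h1, h2⟩
  refine ⟨l.pmap Fin.mk h2, ?_, by rw [List.map_pmap]; simp⟩
  have := (h1.subperm (l₂ := List.range n) (fun a ha => by simpa using h2 a ha)).length_le
  simpa using this

/-- There are finitely many sequents over finitely many formulas and letters. -/
theorem finite_sequents {P : Type u} {V : Type v} {F : Set (Form P V)} (hF : F.Finite) (n : ℕ) :
    {s : BSeq P V | (∀ a ∈ s.raw.control, a < n) ∧ BForm.erase '' s.raw.forms ⊆ F}.Finite := by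
  have hW := finite_nodup_bounded n
  have hG := (hF.biUnion fun ψ _ => BForm.finite_of_erase_eq hW ψ).finite_subsets
  refine Set.Finite.of_finite_image (f := fun s => (s.raw.control, s.raw.forms))
    ((hW.prod hG).subset ?_) ?_
  · rintro _ ⟨s, ⟨h1, h2⟩, rfl⟩
    refine ⟨⟨s.wf.1, h1⟩, fun φ hφ => Set.mem_biUnion (h2 ⟨φ, hφ, rfl⟩) ⟨rfl, fun u hu => ?_⟩⟩
    have := (s.wf.2.2 φ hφ).2 u hu
    exact ⟨s.wf.1.sublist this, fun a ha => h1 a (this.subset ha)⟩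
  · rintro ⟨⟨c, f⟩, _⟩ - ⟨⟨c', f'⟩, _⟩ - h
    obtain rfl : c = c' := congrArg Prod.fst h
    obtain rfl : f = f' := congrArg Prod.snd h
    rfl

variable {P : Type u} {V : Type v}

/-! ### Tracking annotations through rule instances -/

/-- How the annotation of a tracked quantifier may change in a rule instance that resets the
letters in `Res`. -/
def AnnotStep (Res : ℕ → Prop) (Θ u u' : List ℕ) : Prop :=
  u' = u ∨ StackLt Θ u' u ∨ ∃ b, Res b ∧ u' = resetWord b u

/-- The annotated formulas in `Γ'` follow those in `Γ` along the trace relation `T`; activated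
traces decrease annotations. -/
def Tracks (Res : ℕ → Prop) (Θ : List ℕ) (Γ Γ' : Set (BForm P V))
    (T : TraceRel (Form P V × List Bool) Bool) : Prop :=
  ∀ z c z', T z c z' → ∀ φ ∈ Γ, φ.erase = z.1 → ∀ u, φ.annotAt z.2 = some u →
    ∃ φ' ∈ Γ', φ'.erase = z'.1 ∧ ∃ u', φ'.annotAt z'.2 = some u' ∧ AnnotStep Res Θ u u' ∧
      (c = true → StackLt Θ u' u)

theorem mem_trim {Θ : List ℕ} {Γ : Set (BForm P V)} {a : ℕ} :
    a ∈ (trim Θ Γ).control ↔ a ∈ Θ ∧ Occurs a Γ := by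
  simp [trim]

theorem trim_control_sublist (Θ : List ℕ) (Γ : Set (BForm P V)) :
    (trim Θ Γ).control.Sublist Θ := List.filter_sublist

theorem sublist_trim {Θ : List ℕ} {Γ : Set (BForm P V)} {φ : BForm P V} {u : List ℕ} (hφ : φ ∈ Γ)
    (hu : u ∈ φ.annots) (h : u.Sublist Θ) : u.Sublist (trim Θ Γ).control := by
  have := h.filter (fun a => Classical.propDecidable (Occurs a Γ) |>.decide)
  rw [List.filter_eq_self.2] at this
  · exact this
  · intro a ha
    exact @decide_eq_true _ (_) (⟨φ, hφ, u, hu, ha⟩ : Occurs a Γ)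

theorem trim_wf {Θ : List ℕ} {Γ : Set (BForm P V)} (h : BRawSeq.WF ⟨Θ, Γ⟩) : (trim Θ Γ).WF :=
  ⟨h.1.filter _, h.2.1, fun φ hφ => ⟨(h.2.2 φ hφ).1, fun u hu =>
    sublist_trim hφ hu ((h.2.2 φ hφ).2 u hu)⟩⟩

/-! ### Normal sequents -/

/-- No two formulas agree up to annotations, and no letter is covered. -/
def BSeq.Normal (s : BSeq P V) : Prop :=
  s.raw.forms.InjOn BForm.erase ∧ ∀ a ∈ s.raw.control, ¬ Covered a s.raw.forms

/-- A measure that decreases under merging and resetting. -/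
noncomputable def BSeq.measure (s : BSeq P V) : ℕ :=
  ∑ φ ∈ s.wf.2.1.toFinset, (1 + φ.weight) + s.raw.control.length

/-- No letter is covered, so each is the last letter of an annotation at some position. Erasure is
injective on the sequent, so a position has only one annotation, and last letters define a map from
positions onto a superset of the control. -/
theorem BSeq.Normal.length_le {s : BSeq P V} (hs : s.Normal) :
    s.raw.control.length ≤ (nuPositions (BForm.erase '' s.raw.forms)).ncard := by
  let r : Form P V × List Bool → ℕ → Prop := fun p a => ∃ φ ∈ s.raw.forms, φ.erase = p.1 ∧
    ∃ u, φ.annotAt p.2 = some u ∧ u.getLast? = some a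
  have hr : ∀ p, ∃ a, ∀ a', r p a' → a' = a := by
    intro p
    by_cases h : ∃ a, r p a
    · obtain ⟨a, φ, hφ, e, u, hu, h⟩ := h
      refine ⟨a, ?_⟩
      rintro a' ⟨φ', hφ', e', u', hu', h'⟩
      obtain rfl := hs.1 hφ hφ' (e.trans e'.symm)
      rw [hu] at hu'
      obtain rfl := Option.some.inj hu'
      rw [h] at h'
      exact (Option.some.inj h').symm
    -- The value at pairs without a last letter is irrelevant.
    · exact ⟨0, fun a' h' => absurd ⟨a', h'⟩ h⟩
  choose g hg using hr
  have hfin := nuPositions_finite (s.wf.2.1.image BForm.erase)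
  rw [← List.toFinset_card_of_nodup s.wf.1, ← Set.ncard_coe_finset]
  refine (Set.ncard_le_ncard ?_ (hfin.image g)).trans (Set.ncard_image_le hfin)
  intro a ha
  have := hs.2 a (by simpa using ha)
  simp only [Covered] at this
  push Not at this
  obtain ⟨φ, hφ, u, hu, h⟩ := this
  obtain ⟨b, hb⟩ := BForm.exists_annotAt hu
  exact ⟨(φ.erase, b), ⟨⟨φ, hφ, rfl⟩, BForm.mem_nuAddr_erase_iff.2 ⟨u, hb⟩⟩,
    (hg (φ.erase, b) a ⟨φ, hφ, rfl, u, hb, h⟩).symm⟩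

/-- A sequent that is not normal can be simplified by merging or resetting. -/
theorem BSeq.exists_simplify {s : BSeq P V} (hs : ¬ s.Normal) :
    ∃ (R : BRule P V) (s' : BSeq P V), R.raw.concl = s.raw ∧ R.raw.prems = [s'.raw] ∧
      BForm.erase '' s'.raw.forms = BForm.erase '' s.raw.forms ∧
      s'.raw.control.Sublist s.raw.control ∧ s'.measure < s.measure ∧
      Tracks (fun b => R.IsReset b) s.raw.control s.raw.forms s'.raw.forms
        (fun z c z' => c = false ∧ z' = z) := by
  classical
  obtain ⟨⟨Θ, Γ⟩, hwf⟩ := s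
  obtain ⟨hnd, hfin, hΓ⟩ := id hwf
  dsimp only at hnd hfin hΓ
  by_cases hinj : Γ.InjOn BForm.erase
  · have : ∃ a ∈ Θ, Covered a Γ := by
      by_contra hcon
      push Not at hcon
      exact hs ⟨hinj, hcon⟩
    obtain ⟨a, ha, hcov⟩ := this
    have hwf' : (trim Θ (BForm.reset a '' Γ)).WF := by
      refine trim_wf ⟨hnd, hfin.image _, ?_⟩
      rintro _ ⟨φ, hφ, rfl⟩
      refine ⟨by rw [BForm.erase_reset]; exact (hΓ φ hφ).1, fun u hu => ?_⟩
      obtain ⟨v, hv, rfl⟩ := BForm.exists_of_mem_annots_reset hu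
      exact (resetWord_sublist a v).trans ((hΓ φ hφ).2 v hv)
    refine ⟨⟨.reset Θ Γ a, ⟨ha, hcov⟩, hwf, by simpa [BRaw.prems] using hwf'⟩, ⟨_, hwf'⟩,
      rfl, rfl, ?_, trim_control_sublist _ _, ?_, ?_⟩
    · simp only [trim, Set.image_image, BForm.erase_reset]
    · have hsum : ∑ φ ∈ (hfin.image (BForm.reset a)).toFinset, (1 + φ.weight) =
          ∑ φ ∈ hfin.toFinset, (1 + (BForm.reset a φ).weight) := by
        rw [Set.Finite.toFinset_image _ hfin, Finset.sum_image]
        intro φ hφ ψ hψ e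
        refine hinj (by simpa using hφ) (by simpa using hψ) ?_
        rw [← BForm.erase_reset a φ, e, BForm.erase_reset]
      have hctrl := (trim_control_sublist Θ (BForm.reset a '' Γ)).length_le
      have hle : ∀ φ ∈ hfin.toFinset, 1 + (BForm.reset a φ).weight ≤ 1 + φ.weight :=
        fun φ _ => Nat.add_le_add_left (BForm.weight_reset_le a φ) 1
      change ∑ φ ∈ (hfin.image (BForm.reset a)).toFinset, (1 + φ.weight) + _ <
        ∑ φ ∈ hfin.toFinset, (1 + φ.weight) + Θ.length
      rw [hsum]
      -- If `a` occurs, it is followed by letters that the reset cuts off, as it is covered; if not,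
      -- trimming removes it from the control.
      by_cases hocc : Occurs a Γ
      · obtain ⟨φ, hφ, u, hu, hau⟩ := hocc
        have := Finset.sum_lt_sum hle ⟨φ, by simpa using hφ,
          Nat.add_lt_add_left (BForm.weight_reset_lt hu hau (hcov φ hφ u hu)) 1⟩
        exact Nat.add_lt_add_of_lt_of_le this hctrl
      · refine Nat.add_lt_add_of_le_of_lt (Finset.sum_le_sum hle) ?_
        refine lt_of_le_of_ne hctrl fun e => hocc ?_
        have h1 := (trim_control_sublist Θ (BForm.reset a '' Γ)).eq_of_length e
        rw [← h1, mem_trim] at ha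
        obtain ⟨-, _, ⟨φ, hφ, rfl⟩, u, hu, hau⟩ := ha
        obtain ⟨v, hv, rfl⟩ := BForm.exists_of_mem_annots_reset hu
        exact ⟨φ, hφ, v, hv, resetWord_subset hau⟩
    · rintro z c z' ⟨rfl, rfl⟩ φ hφ e u hu
      refine ⟨BForm.reset a φ, ⟨φ, hφ, rfl⟩, by rw [BForm.erase_reset, e], resetWord a u, ?_,
        .inr (.inr ⟨a, ⟨Θ, Γ, rfl⟩, rfl⟩), by simp⟩
      rw [BForm.annotAt_reset, hu]
      rfl
  · simp only [Set.InjOn] at hinj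
    push Not at hinj
    obtain ⟨φ, hφ, ψ, hψ, e, hne⟩ := hinj
    obtain ⟨ξ, hξ⟩ := BForm.exists_merge e (hΓ φ hφ).2 (hΓ ψ hψ).2
    let Δ := Γ \ {φ, ψ}
    have hΔ : Δ ∪ {φ, ψ} = Γ := Set.sdiff_union_of_subset (by simp [Set.insert_subset_iff, hφ, hψ])
    have hwf' : (trim Θ (Δ ∪ {ξ})).WF := by
      refine trim_wf ⟨hnd, (hfin.subset Set.sdiff_subset).union (Set.finite_singleton _), ?_⟩
      rintro χ (hχ | rfl)
      · exact hΓ χ hχ.1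
      · refine ⟨by rw [hξ.erase_left]; exact (hΓ φ hφ).1, fun u hu => ?_⟩
        rcases hξ.annots_subset hu with hu | hu
        · exact (hΓ φ hφ).2 u hu
        · exact (hΓ ψ hψ).2 u hu
    have hc : BRaw.concl (.merge Θ Δ φ ψ ξ) = ⟨Θ, Γ⟩ := by rw [BRaw.concl, hΔ]
    refine ⟨⟨.merge Θ Δ φ ψ ξ, hξ, by rw [hc]; exact hwf, by simpa [BRaw.prems] using hwf'⟩,
      ⟨_, hwf'⟩, hc, rfl, ?_, trim_control_sublist _ _, ?_, ?_⟩
    · simp only [trim]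
      conv_rhs => rw [← hΔ]
      rw [Set.image_union, Set.image_union, Set.image_pair, Set.image_singleton, ← e,
        hξ.erase_left, Set.pair_eq_singleton]
    · have hctrl := (trim_control_sublist Θ (Δ ∪ {ξ})).length_le
      have hΔf : Δ.Finite := hfin.subset Set.sdiff_subset
      -- Only an inequality, since `ξ` may already be in `Δ`. The summand `1` per formula makes the
      -- measure drop even if `ξ` has the full weight of `φ` and `ψ` together.
      have h1 : ∑ χ ∈ hwf'.2.1.toFinset, (1 + χ.weight) ≤
          ∑ χ ∈ hΔf.toFinset, (1 + χ.weight) + (1 + ξ.weight) := by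
        have : hwf'.2.1.toFinset = hΔf.toFinset ∪ {ξ} := by
          ext χ; simp [trim]
        rw [this]
        have := Finset.sum_union_inter (s₁ := hΔf.toFinset) (s₂ := {ξ})
          (f := fun χ : BForm P V => 1 + χ.weight)
        rw [Finset.sum_singleton] at this
        omega
      have h2 : ∑ χ ∈ hfin.toFinset, (1 + χ.weight) =
          ∑ χ ∈ hΔf.toFinset, (1 + χ.weight) + ((1 + φ.weight) + (1 + ψ.weight)) := by
        have : hfin.toFinset = hΔf.toFinset ∪ {φ, ψ} := by
          ext χ
          rw [Set.Finite.mem_toFinset, ← hΔ]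
          simp
        rw [this, Finset.sum_union, Finset.sum_pair hne]
        rw [Finset.disjoint_right]
        intro χ hχ hχ'
        have := (hΔf.mem_toFinset.1 hχ').2
        simp at hχ this
        tauto
      have h3 := hξ.weight_le
      change ∑ χ ∈ hwf'.2.1.toFinset, (1 + χ.weight) + (trim Θ (Δ ∪ {ξ})).control.length <
        ∑ χ ∈ hfin.toFinset, (1 + χ.weight) + Θ.length
      omega
    · rintro z c z' ⟨rfl, rfl⟩ χ hχ e' u hu
      by_cases hχ' : χ ∈ Δ
      · exact ⟨χ, .inl hχ', e', u, hu, .inl rfl, by simp⟩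
      have hχ'' : χ = φ ∨ χ = ψ := by
        by_contra hcon
        exact hχ' ⟨hχ, by simpa using hcon⟩
      rcases hξ.annotAt_cases z'.2 with ⟨h1, h2, -⟩ | ⟨v, w, hv, hw, hv', hw', h⟩
      · rcases hχ'' with rfl | rfl
        · rw [h1] at hu; cases hu
        · rw [h2] at hu; cases hu
      refine ⟨ξ, .inr rfl, ?_, _, h, ?_, by simp⟩
      · rw [hξ.erase_left, ← e']
        rcases hχ'' with rfl | rfl
        · rfl
        · exact e
      -- `stackMin` defaults to the second word, so trichotomy is needed only if the tracked word is
      -- the first.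
      · unfold stackMin
        rcases hχ'' with rfl | rfl
        · obtain rfl : u = v := by rw [hv] at hu; exact (Option.some.inj hu).symm
          split_ifs with hlt
          · exact .inl rfl
          · rcases stackLt_trichotomy hnd hv' hw' with h | h | h
            · exact absurd h hlt
            · exact .inl h.symm
            · exact .inr (.inl h)
        · obtain rfl : u = w := by rw [hw] at hu; exact (Option.some.inj hu).symm
          split_ifs with hlt
          · exact .inr (.inl hlt)
          · exact .inl rfl

/-! ### Lifting rules to normal annotated sequents -/

/-- The formulas that become members of `Γ` when the annotations are removed. -/
def liftCtx (F : Set (BForm P V)) (Γ : Set (Form P V)) : Set (BForm P V) :=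
  {φ ∈ F | φ.erase ∈ Γ}

theorem image_liftCtx {F : Set (BForm P V)} {Γ : Set (Form P V)} (h : Γ ⊆ BForm.erase '' F) :
    BForm.erase '' liftCtx F Γ = Γ := by
  ext φ
  constructor
  · rintro ⟨ψ, hψ, rfl⟩
    exact hψ.2
  · intro hφ
    obtain ⟨ψ, hψ, rfl⟩ := h hφ
    exact ⟨ψ, ⟨hψ, hφ⟩, rfl⟩

/-- By injectivity `χ` is the only annotated copy of the principal formula, so no other formula of
`F` falls outside the lifted context. -/
theorem liftCtx_union {F : Set (BForm P V)} {Γ : Set (Form P V)} {χ : BForm P V}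
    (hF : F.InjOn BForm.erase) (h : BForm.erase '' F = Γ ∪ {χ.erase}) (hχ : χ ∈ F) :
    liftCtx F Γ ∪ {χ} = F := by
  ext φ
  constructor
  · rintro (hφ | rfl)
    exacts [hφ.1, hχ]
  · intro hφ
    have : φ.erase ∈ Γ ∪ {χ.erase} := h ▸ ⟨φ, hφ, rfl⟩
    rcases this with h' | h'
    · exact .inl ⟨hφ, h'⟩
    · exact .inr (hF hφ hχ h')

/-- `d` is a sequent over the formulas `Δ` to which annotations are tracked from `s`. -/
structure IsLift (s : BSeq P V) (Ξ : List ℕ) (Δ : Set (Form P V))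
    (T : TraceRel (Form P V × List Bool) Bool) (d : BRawSeq P V) : Prop where
  control : d.control.Sublist Ξ
  finite : d.forms.Finite
  annots : ∀ φ ∈ d.forms, ∀ u ∈ φ.annots, u.Sublist d.control
  image : BForm.erase '' d.forms = Δ
  tracks : Tracks (fun _ => False) Ξ s.raw.forms d.forms T

theorem IsLift.trim {s : BSeq P V} {Ξ Θ : List ℕ} {Δ : Set (Form P V)}
    {T : TraceRel (Form P V × List Bool) Bool} {Γ : Set (BForm P V)}
    (h : IsLift s Ξ Δ T ⟨Θ, Γ⟩) : IsLift s Ξ Δ T (trim Θ Γ) where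
  control := (trim_control_sublist Θ Γ).trans h.control
  finite := h.finite
  annots φ hφ u hu := sublist_trim hφ hu (h.annots φ hφ u hu)
  image := h.image
  tracks := h.tracks

variable {s : BSeq P V} {Ξ : List ℕ} {Γ : Set (Form P V)} {N : Set (BForm P V)}
  {T : TraceRel (Form P V × List Bool) Bool}

theorem isLift_ctx_union {Θ : List ℕ} (hs : s.raw.control.Sublist Θ) (hΘ : Θ.Sublist Ξ)
    (hΓ : Γ ⊆ BForm.erase '' s.raw.forms) (hN : N.Finite)
    (hann : ∀ φ ∈ N, ∀ u ∈ φ.annots, u.Sublist Θ) {Δ : Set (Form P V)}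
    (hΔ : Γ ∪ BForm.erase '' N = Δ)
    (hT : Tracks (fun _ => False) Ξ s.raw.forms (liftCtx s.raw.forms Γ ∪ N) T) :
    IsLift s Ξ Δ T ⟨Θ, liftCtx s.raw.forms Γ ∪ N⟩ where
  control := hΘ
  finite := (s.wf.2.1.subset fun _ h => h.1).union hN
  annots φ hφ u hu := hφ.elim (fun h => ((s.wf.2.2 φ h.1).2 u hu).trans hs) (fun h => hann φ h u hu)
  image := by rw [Set.image_union, image_liftCtx hΓ, hΔ]
  tracks := hT

theorem tracks_ctx : Tracks (fun _ => False) Ξ s.raw.forms (liftCtx s.raw.forms Γ ∪ N)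
    (traceCtx Γ) := by
  rintro z c z' ⟨hz, rfl, rfl⟩ φ hφ e u hu
  exact ⟨φ, .inl ⟨hφ, e ▸ hz.1⟩, e, u, hu, .inl rfl, by simp⟩

theorem Tracks.or {Res : ℕ → Prop} {F F' : Set (BForm P V)}
    {T' : TraceRel (Form P V × List Bool) Bool} (h : Tracks Res Ξ F F' T)
    (h' : Tracks Res Ξ F F' T') : Tracks Res Ξ F F' (fun w c w' => T w c w' ∨ T' w c w') :=
  fun z c z' hz => hz.elim (h z c z') (h' z c z')

/-- Tracking concerns all annotated copies of `χ₀`; injectivity of erasure leaves only `χ`. -/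
theorem tracks_sub {F F' : Set (BForm P V)} (hF : F.InjOn BForm.erase) {χ ψ : BForm P V}
    {i : Bool} (hχ : χ ∈ F) (hψ : ψ ∈ F') (h : ∀ a, χ.annotAt (i :: a) = ψ.annotAt a)
    {χ₀ ψ₀ : Form P V} (eχ : χ.erase = χ₀) (eψ : ψ.erase = ψ₀) :
    Tracks (fun _ => False) Ξ F F' (traceSub χ₀ i ψ₀) := by
  rintro z c z' ⟨a, rfl, rfl, rfl⟩ φ hφ e u hu
  obtain rfl := hF hφ hχ (e.trans eχ.symm)
  exact ⟨ψ, hψ, eψ, u, by rw [← h]; exact hu, .inl rfl, by simp⟩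

/-- Serves both fixed-point rules: `χ'` has the annotations of `χ` except for a smaller one at the
root. For `μ` the root has none, so `hroot` is vacuous and the value `b` does not matter. -/
theorem tracks_fix {F F' : Set (BForm P V)} (hF : F.InjOn BForm.erase) {χ χ' φ : BForm P V}
    {x : V} {b : Bool} (hχ : χ ∈ F) (hφ : φ.subst x χ' ∈ F')
    (h : ∀ a, χ.annotAt (false :: a) = φ.annotAt a)
    (h' : ∀ a, χ'.annotAt (false :: a) = φ.annotAt a)
    (hroot : ∀ u, χ.annotAt [] = some u → ∃ u', χ'.annotAt [] = some u' ∧ StackLt Ξ u' u)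
    {χ₀ φ₀ ψ₀ : Form P V} (eχ : χ.erase = χ₀) (eφ : φ.erase = φ₀)
    (eψ : (φ.subst x χ').erase = ψ₀) :
    Tracks (fun _ => False) Ξ F F' (traceFix χ₀ x φ₀ ψ₀ b) := by
  subst eφ
  rintro z c z' hz ψ hψ e u hu
  obtain rfl : ψ = χ := by
    refine hF hψ hχ (e.trans ?_)
    rcases hz with ⟨a, -, rfl, -⟩ | ⟨a, -, rfl, -⟩ | ⟨a, -, b, -, rfl, -⟩ <;> exact eχ.symm
  rcases hz with ⟨a, ha, rfl, rfl, rfl⟩ | ⟨a, ha, rfl, rfl, rfl⟩ | ⟨a, ha, a', ha', rfl, rfl, rfl⟩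
  · obtain ⟨u', hu', hlt⟩ := hroot u hu
    refine ⟨_, hφ, eψ, u', ?_, .inr (.inl hlt), fun _ => hlt⟩
    have := BForm.annotAt_subst_append (χ := χ') (b := []) ha.1
    rw [List.append_nil] at this
    exact this.trans hu'
  · refine ⟨_, hφ, eψ, u, BForm.annotAt_subst ?_, .inl rfl, by simp⟩
    rw [← h]; exact hu
  · refine ⟨_, hφ, eψ, u, ?_, .inl rfl, by simp⟩
    have := BForm.annotAt_subst_append (χ := χ') (b := false :: a) ha'.1
    refine this.trans ?_
    rw [h', ← h]; exact hu

/-- Every rule instance of the cyclic system lifts to normal annotated sequents over its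
conclusion. -/
theorem BSeq.Normal.exists_lift {s : BSeq P V} (hs : s.Normal) {k : KRaw P V} (hk : k.Side)
    (hc : BForm.erase '' s.raw.forms = k.concl) {a : ℕ} (ha : a ∉ s.raw.control) :
    ∃ (b : BRaw P V) (Ξ : List ℕ), b.Side ∧ b.concl = s.raw ∧ s.raw.control <+: Ξ ∧ Ξ.Nodup ∧
      (∀ c ∈ Ξ, c ∈ s.raw.control ∨ c = a) ∧ b.prems.length = k.prems.length ∧
      ∀ (i : ℕ) (h : i < b.prems.length) (h' : i < k.prems.length),
        IsLift s Ξ k.prems[i] (k.trace i) b.prems[i] := by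
  have hinj := hs.1
  obtain ⟨hnd, hfin, hwf⟩ := s.wf
  have hann : ∀ φ ∈ s.raw.forms, ∀ u ∈ φ.annots, u.Sublist s.raw.control :=
    fun φ hφ => (hwf φ hφ).2
  have hmem : ∀ {φ₀}, φ₀ ∈ k.concl → ∃ φ ∈ s.raw.forms, φ.erase = φ₀ := fun h => by
    rw [← hc] at h; exact h
  have hconcl : ∀ {F : Set (BForm P V)}, F = s.raw.forms → ⟨s.raw.control, F⟩ = s.raw :=
    fun h => by rw [h]
  have hΞ : ∀ c ∈ s.raw.control, c ∈ s.raw.control ∨ c = a := fun c h => .inl h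
  cases k with
  | ax p =>
    refine ⟨.ax s.raw.control p, s.raw.control, trivial, hconcl ?_, List.prefix_rfl, hnd, hΞ, rfl,
      fun i h => absurd h (by simp [BRaw.prems])⟩
    ext φ
    have h1 : ∀ φ₀, φ₀ ∈ BForm.erase '' s.raw.forms ↔ φ₀ = .prop p ∨ φ₀ = .nprop p := by
      intro φ₀; rw [hc]; rfl
    constructor
    · rintro (rfl | rfl)
      · obtain ⟨ψ, hψ, e⟩ := (h1 (.prop p)).2 (.inl rfl)
        cases ψ <;> simp only [BForm.erase] at e <;> try contradiction
        cases e; exact hψ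
      · obtain ⟨ψ, hψ, e⟩ := (h1 (.nprop p)).2 (.inr rfl)
        cases ψ <;> simp only [BForm.erase] at e <;> try contradiction
        cases e; exact hψ
    · intro hφ
      rcases (h1 φ.erase).1 ⟨φ, hφ, rfl⟩ with e | e <;> cases φ <;>
        simp only [BForm.erase] at e <;> try contradiction
      · cases e; exact .inl rfl
      · cases e; exact .inr rfl
  | wk Γ φ₀ =>
    obtain ⟨φ, hφ, rfl⟩ := hmem (.inr rfl)
    have hΓ : Γ ⊆ BForm.erase '' s.raw.forms := by rw [hc]; exact Set.subset_union_left
    refine ⟨.wk s.raw.control (liftCtx s.raw.forms Γ) φ, s.raw.control, trivial,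
      hconcl (liftCtx_union hinj hc hφ), List.prefix_rfl, hnd, hΞ, rfl, ?_⟩
    intro i h h'
    obtain rfl : i = 0 := by simpa [KRaw.prems] using h'
    have := isLift_ctx_union (N := ∅) (List.Sublist.refl _) (List.Sublist.refl _) hΓ
      Set.finite_empty (by simp) (Δ := Γ) (by simp) tracks_ctx
    rw [Set.union_empty] at this
    exact this.trim
  | or Γ φ₀ ψ₀ =>
    obtain ⟨χ, hχ, e⟩ := hmem (.inr rfl)
    have hΓ : Γ ⊆ BForm.erase '' s.raw.forms := by rw [hc]; exact Set.subset_union_left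
    obtain ⟨φ, ψ, rfl, rfl, rfl⟩ : ∃ φ ψ, χ = .or φ ψ ∧ φ.erase = φ₀ ∧ ψ.erase = ψ₀ := by
      cases χ <;> simp only [BForm.erase] at e <;> try contradiction
      injection e with e₁ e₂
      exact ⟨_, _, rfl, e₁, e₂⟩
    refine ⟨.or s.raw.control (liftCtx s.raw.forms Γ) φ ψ, s.raw.control, trivial,
      hconcl (liftCtx_union hinj hc hχ), List.prefix_rfl, hnd, hΞ, rfl, ?_⟩
    intro i h h'
    obtain rfl : i = 0 := by simpa [KRaw.prems] using h'
    refine isLift_ctx_union (List.Sublist.refl _) (List.Sublist.refl _) hΓ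
      (Set.toFinite _) ?_ (by rw [Set.image_pair]; rfl) (tracks_ctx.or (.or
        (tracks_sub hinj hχ (.inr (.inl rfl)) (fun _ => rfl) rfl rfl)
        (tracks_sub hinj hχ (.inr (.inr rfl)) (fun _ => rfl) rfl rfl)))
    rintro _ (rfl | rfl) u hu
    exacts [hann _ hχ u (.inl hu), hann _ hχ u (.inr hu)]
  | and Γ φ₀ ψ₀ =>
    obtain ⟨χ, hχ, e⟩ := hmem (.inr rfl)
    have hΓ : Γ ⊆ BForm.erase '' s.raw.forms := by rw [hc]; exact Set.subset_union_left
    obtain ⟨φ, ψ, rfl, rfl, rfl⟩ : ∃ φ ψ, χ = .and φ ψ ∧ φ.erase = φ₀ ∧ ψ.erase = ψ₀ := by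
      cases χ <;> simp only [BForm.erase] at e <;> try contradiction
      injection e with e₁ e₂
      exact ⟨_, _, rfl, e₁, e₂⟩
    refine ⟨.and s.raw.control (liftCtx s.raw.forms Γ) φ ψ, s.raw.control, trivial,
      hconcl (liftCtx_union hinj hc hχ), List.prefix_rfl, hnd, hΞ, rfl, ?_⟩
    intro i h h'
    obtain rfl | rfl : i = 0 ∨ i = 1 := by simp [KRaw.prems] at h'; omega
    · refine (isLift_ctx_union (List.Sublist.refl _) (List.Sublist.refl _) hΓ
        (Set.toFinite _) ?_ (by rw [Set.image_singleton]; rfl) (tracks_ctx.or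
          (tracks_sub hinj hχ (.inr rfl) (fun _ => rfl) rfl rfl))).trim
      rintro _ rfl u hu
      exact hann _ hχ u (.inl hu)
    · refine (isLift_ctx_union (List.Sublist.refl _) (List.Sublist.refl _) hΓ
        (Set.toFinite _) ?_ (by rw [Set.image_singleton]; rfl) (tracks_ctx.or
          (tracks_sub hinj hχ (.inr rfl) (fun _ => rfl) rfl rfl))).trim
      rintro _ rfl u hu
      exact hann _ hχ u (.inr hu)
  | mod Γ φ₀ =>
    obtain ⟨χ, hχ, e⟩ := hmem (.inr rfl)
    obtain ⟨φ, rfl, rfl⟩ : ∃ φ, χ = .box φ ∧ φ.erase = φ₀ := by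
      cases χ <;> simp only [BForm.erase] at e <;> try contradiction
      injection e with e₁
      exact ⟨_, rfl, e₁⟩
    have hdia : ∀ {χ : BForm P V} {ψ₀}, χ.erase = .dia ψ₀ → ∃ ψ, χ = .dia ψ ∧ ψ.erase = ψ₀ := by
      intro χ ψ₀ e
      cases χ <;> simp only [BForm.erase] at e <;> try contradiction
      injection e with e₁
      exact ⟨_, rfl, e₁⟩
    -- The modal rule takes its context without diamonds, so the lift is formed one level down.
    let G : Set (BForm P V) := {ψ | .dia ψ ∈ s.raw.forms ∧ ψ.erase ∈ Γ}
    have hG : BForm.dia '' G = liftCtx s.raw.forms (Form.dia '' Γ) := by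
      ext ψ
      constructor
      · rintro ⟨ψ, ⟨h1, h2⟩, rfl⟩
        exact ⟨h1, ψ.erase, h2, rfl⟩
      · rintro ⟨h1, ψ₀, h2, h3⟩
        obtain ⟨ψ, rfl, rfl⟩ := hdia h3.symm
        exact ⟨ψ, ⟨h1, h2⟩, rfl⟩
    refine ⟨.mod s.raw.control G φ, s.raw.control, trivial,
      hconcl (by rw [hG]; exact liftCtx_union hinj hc hχ), List.prefix_rfl, hnd, hΞ, rfl, ?_⟩
    intro i h h'
    obtain rfl : i = 0 := by simpa [KRaw.prems] using h'
    have hGf : G.Finite := by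
      refine Set.Finite.of_finite_image (f := BForm.dia) ?_ fun _ _ _ _ h => by injection h
      rw [hG]
      exact hfin.subset fun _ h => h.1
    refine ⟨List.Sublist.refl _, hGf.union (Set.finite_singleton _), ?_, ?_, ?_⟩
    · rintro ψ (hψ | rfl) u hu
      · exact hann _ hψ.1 u hu
      · exact hann _ hχ u hu
    · change BForm.erase '' (G ∪ {φ}) = Γ ∪ {φ.erase}
      rw [Set.image_union, Set.image_singleton]
      congr 1
      ext ψ₀
      constructor
      · rintro ⟨ψ, hψ, rfl⟩
        exact hψ.2
      · intro hψ
        obtain ⟨ψ, hψ', e⟩ := hmem (.inl ⟨ψ₀, hψ, rfl⟩)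
        obtain ⟨ψ, rfl, rfl⟩ := hdia e
        exact ⟨ψ, ⟨hψ', hψ⟩, rfl⟩
    · refine Tracks.or ?_ (tracks_sub hinj hχ (.inr rfl) (fun _ => rfl) rfl rfl)
      rintro z c z' ⟨ψ₀, hψ₀, hz⟩
      obtain ⟨ψ, hψ, e⟩ := hmem (.inl ⟨ψ₀, hψ₀, rfl⟩)
      obtain ⟨ψ, rfl, rfl⟩ := hdia e
      exact tracks_sub hinj hψ (.inl ⟨hψ, hψ₀⟩) (fun _ => rfl) rfl rfl z c z' hz
  | mu Γ x φ₀ =>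
    obtain ⟨χ, hχ, e⟩ := hmem (.inr rfl)
    have hΓ : Γ ⊆ BForm.erase '' s.raw.forms := by rw [hc]; exact Set.subset_union_left
    obtain ⟨φ, rfl, rfl⟩ : ∃ φ, χ = .mu x φ ∧ φ.erase = φ₀ := by
      cases χ <;> simp only [BForm.erase] at e <;> try contradiction
      injection e with e₁ e₂
      exact ⟨_, by rw [e₁], e₂⟩
    refine ⟨.mu s.raw.control (liftCtx s.raw.forms Γ) x φ, s.raw.control, hk,
      hconcl (liftCtx_union hinj hc hχ), List.prefix_rfl, hnd, hΞ, rfl, ?_⟩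
    intro i h h'
    obtain rfl : i = 0 := by simpa [KRaw.prems] using h'
    have he := BForm.erase_subst φ x (.mu x φ)
    refine isLift_ctx_union (List.Sublist.refl _) (List.Sublist.refl _) hΓ
      (Set.toFinite _) ?_ (by rw [Set.image_singleton, he]; rfl) (tracks_ctx.or
        (tracks_fix hinj hχ (.inr rfl) (fun _ => rfl) (fun _ => rfl) ?_ rfl rfl he))
    · rintro _ rfl u hu
      rcases BForm.annots_subst hu with hu | hu <;> exact hann _ hχ u hu
    · intro u hu
      cases hu
  | nu Γ x φ₀ =>
    obtain ⟨χ, hχ, e⟩ := hmem (.inr rfl)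
    have hΓ : Γ ⊆ BForm.erase '' s.raw.forms := by rw [hc]; exact Set.subset_union_left
    obtain ⟨u, φ, rfl, rfl⟩ : ∃ u φ, χ = .nu u x φ ∧ φ.erase = φ₀ := by
      cases χ <;> simp only [BForm.erase] at e <;> try contradiction
      injection e with e₁ e₂
      exact ⟨_, _, by rw [e₁], e₂⟩
    have hu := hann _ hχ u (.inl rfl)
    -- Only here is `Ξ` longer than the control: the old and new annotations are compared after the
    -- fresh letter has been appended.
    refine ⟨.nu s.raw.control (liftCtx s.raw.forms Γ) u x φ a, s.raw.control ++ [a], ⟨hk, ha⟩,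
      hconcl (liftCtx_union hinj hc hχ), List.prefix_append _ _, ?_, by simp, rfl, ?_⟩
    · rw [List.nodup_append]
      refine ⟨hnd, by simp, ?_⟩
      rintro c hc d hd rfl
      exact ha (List.mem_singleton.1 hd ▸ hc)
    intro i h h'
    obtain rfl : i = 0 := by simpa [KRaw.prems] using h'
    have he := BForm.erase_subst φ x (.nu (u ++ [a]) x φ)
    refine isLift_ctx_union (List.sublist_append_left _ _) (List.Sublist.refl _) hΓ
      (Set.toFinite _) ?_ (by rw [Set.image_singleton, he]; rfl) (tracks_ctx.or
        (tracks_fix hinj hχ (.inr rfl) (fun _ => rfl) (fun _ => rfl) ?_ rfl rfl he))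
    · rintro _ rfl v hv
      rcases BForm.annots_subst hv with hv | hv | hv
      · exact (hann _ hχ v (.inr hv)).trans (List.sublist_append_left _ _)
      · obtain rfl : v = u ++ [a] := hv
        exact hu.append (List.Sublist.refl _)
      · exact (hann _ hχ v (.inr hv)).trans (List.sublist_append_left _ _)
    · intro v hv
      obtain rfl : u = v := Option.some.inj hv
      exact ⟨u ++ [a], rfl, stackLt_append_singleton ha hu⟩

/-! ### Traces as sequences of single steps -/

/-- Unfolds the iterated composition; a boolean join is true only if one of its arguments is. -/
theorem pathSegment_exists_run {U : Type u} {X : ℕ → Set U} {R : ℕ → TraceRel U Bool} {i n : ℕ}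
    {x z : U} {c : Bool} (h : pathSegment X R i n x c z) :
    ∃ (y : ℕ → U) (d : ℕ → Bool), y 0 = x ∧ y n = z ∧
      (∀ k < n, R (i + k) (y k) (d k) (y (k + 1))) ∧ (c = true → ∃ k < n, d k = true) := by
  induction n generalizing z c with
  | zero =>
    obtain ⟨-, rfl, rfl⟩ := h
    exact ⟨fun _ => x, fun _ => false, rfl, rfl, by simp, fun h => absurd h (by decide)⟩
  | succ n ih =>
    obtain ⟨w, a, b, h1, h2, rfl⟩ := h
    obtain ⟨y, d, rfl, rfl, hs, hd⟩ := ih h1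
    refine ⟨fun k => if k ≤ n then y k else z, fun k => if k < n then d k else b, by simp, by simp,
      fun k hk => ?_, fun hab => ?_⟩
    · rcases Nat.lt_succ_iff_lt_or_eq.1 hk with hk | rfl
      · simp only [hk.le, if_true, hk, show k + 1 ≤ n from hk]
        exact hs k hk
      · simpa using h2
    · have : a = true ∨ b = true := by
        revert hab
        cases a <;> cases b <;> decide
      rcases this with h | h
      · obtain ⟨k, hk, hdk⟩ := hd h
        exact ⟨k, by omega, by simp [hk, hdk]⟩
      · exact ⟨n, by omega, by simp [h]⟩

/-- The runs of consecutive segments are glued at their common endpoints, and each segment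
contributes an activated step. -/
theorem TraceCondition.exists_run {U : Type u} {X : ℕ → Set U} {R : ℕ → TraceRel U Bool}
    (h : TraceCondition X R) :
    ∃ (N : ℕ) (y : ℕ → U) (d : ℕ → Bool), (∀ n ≥ N, R n (y n) (d n) (y (n + 1))) ∧
      ∃ᶠ n in atTop, d n = true := by
  obtain ⟨S, hS, x, hx⟩ := h
  choose Y D h0 hlast hstep hact using fun i => pathSegment_exists_run (hx i).2
  -- The index of the segment containing time `n`; it is arbitrary before `S 0`.
  have hex : ∀ n, ∃ k, S 0 ≤ n → S k ≤ n ∧ n < S (k + 1) := by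
    intro n
    by_cases hn : S 0 ≤ n
    · induction n, hn using Nat.le_induction with
      | base => exact ⟨0, fun _ => ⟨le_rfl, hS Nat.zero_lt_one⟩⟩
      | succ n hn ih =>
        obtain ⟨k, hk⟩ := ih
        obtain ⟨h1, h2⟩ := hk hn
        by_cases hk : n + 1 < S (k + 1)
        · exact ⟨k, fun _ => ⟨by omega, hk⟩⟩
        · have : S (k + 1) < S (k + 1 + 1) := hS (Nat.lt_succ_self (k + 1))
          exact ⟨k + 1, fun _ => ⟨by omega, by omega⟩⟩
    · exact ⟨0, fun h => absurd h hn⟩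
  choose κ hκ using hex
  have huniq : ∀ {n k}, S k ≤ n → n < S (k + 1) → κ n = k := by
    intro n k h1 h2
    obtain ⟨h3, h4⟩ := hκ n ((hS.monotone (Nat.zero_le k)).trans h1)
    have h5 := hS.lt_iff_lt.1 (h1.trans_lt h4)
    have h6 := hS.lt_iff_lt.1 (h3.trans_lt h2)
    omega
  refine ⟨S 0, fun n => Y (κ n) (n - S (κ n)), fun n => D (κ n) (n - S (κ n)), fun n hn => ?_, ?_⟩
  · obtain ⟨h1, h2⟩ := hκ n hn
    have h3 := hstep (κ n) (n - S (κ n)) (by omega)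
    rw [Nat.add_sub_cancel' h1] at h3
    by_cases h4 : n + 1 < S (κ n + 1)
    · have := huniq (n := n + 1) (k := κ n) (by omega) h4
      simp only [this]
      rwa [Nat.sub_add_comm h1]
    -- The last step of a segment ends at the starting point of the next one.
    · have h5 : n + 1 = S (κ n + 1) := by omega
      have := huniq (n := n + 1) (k := κ n + 1) h5.ge (h5 ▸ hS (Nat.lt_succ_self _))
      simp only [this]
      rw [← h5, Nat.sub_self, h0, ← hlast, ← h5, Nat.sub_add_comm h1]
      exact h3
  · rw [frequently_atTop]
    intro N
    obtain ⟨k, hk, hd⟩ := hact N rfl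
    have h1 := hS.le_apply (x := N)
    have := huniq (n := S N + k) (k := N) (by omega) (by omega)
    refine ⟨S N + k, by omega, ?_⟩
    simp only [this]
    rwa [Nat.add_sub_cancel_left]

/-! ### Simulation of cyclic proofs -/

section Edges

variable {D : DerivationSystem.{u}} {U : Type w} {A : Type*} [ActivationAlgebra A]

/-- From a node to its children and from a bud to its companion. -/
def Preproof.Edge (pf : Preproof D) (t t' : List ℕ) : Prop :=
  (∃ R, pf.rule t = some R ∧ ∃ j < D.arity R, t' = t ++ [j]) ∨ pf.tree.back t = some t'

/-- The trace relation along an edge. -/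
def Preproof.edgeTrace (pf : Preproof D) (ι : TraceInterpretation D U A) (t t' : List ℕ) :
    TraceRel U A :=
  fun x a y =>
    (∃ (R : D.Rule) (j : Fin (D.arity R)), pf.rule t = some R ∧ t' = t ++ [(j : ℕ)] ∧
      ι.map R j x a y) ∨
    (pf.tree.back t ≠ none ∧ TraceRel.id (ι.obj (pf.label t)) x a y)

theorem Preproof.mem_obj_of_edgeTrace {pf : Preproof D} {ι : TraceInterpretation D U A}
    {t t' : List ℕ} {x y : U} {a : A} (h : pf.edgeTrace ι t t' x a y) :
    x ∈ ι.obj (pf.label t) := by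
  rcases h with ⟨R, j, hR, -, h⟩ | ⟨-, h, -⟩
  · rw [pf.rule_concl hR]
    exact (ι.map_support R j x a y h).1
  · exact h

theorem Preproof.Closed.exists_rule {pf : Preproof D} (hpf : pf.Closed) {t : List ℕ}
    (ht : t ∈ pf.tree.nodes) (hb : pf.tree.back t = none) : ∃ R, pf.rule t = some R := by
  by_contra hcon
  have hn : pf.rule t = none := by
    cases h : pf.rule t with
    | none => rfl
    | some R => exact absurd ⟨R, h⟩ hcon
  exact hcon (hpf t (pf.leaf_of_no_rule ht hb hn) hb)

theorem CyclicTree.root_mem (C : CyclicTree) : [] ∈ C.nodes := by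
  obtain ⟨t, ht⟩ := C.nonempty
  exact C.prefix_closed (List.nil_prefix) ht

theorem Preproof.isBranch_of_edge {pf : Preproof D} {π : ℕ → List ℕ} (h0 : π 0 = [])
    (h : ∀ k, π k ∈ pf.tree.nodes) (he : ∀ k, pf.Edge (π k) (π (k + 1))) :
    pf.tree.IsBranch π := by
  refine ⟨h0, fun k => ⟨h k, ?_, ?_⟩⟩
  · rintro ⟨-, i, hi⟩
    rcases he k with ⟨R, -, j, -, e⟩ | hb
    · exact ⟨j, e⟩
    · exact absurd hi ((pf.tree.back_leaf hb).2 i)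
  · rintro ⟨-, hl⟩
    rcases he k with ⟨R, hR, j, hj, e⟩ | hb
    · exact absurd ((pf.rule_children hR j).2 hj) (hl j)
    · exact hb

end Edges

/-- Supplies the formula needed for the vacuous weakening at a bud. -/
theorem KRaw.concl_nonempty (k : KRaw P V) : k.concl.Nonempty := by
  cases k with
  | ax p => exact ⟨_, .inl rfl⟩
  | _ => exact ⟨_, .inr rfl⟩

/-- An annotated sequent over the sequent at a node, with letters up to `B`. -/
def IsState (pf : Preproof (KDer P V)) (B : ℕ) (t : List ℕ) (s : BSeq P V) : Prop :=
  t ∈ pf.tree.nodes ∧ BForm.erase '' s.raw.forms = (pf.label t).forms ∧ ∀ a ∈ s.raw.control, a ≤ B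

/-- A step of the simulation: it simplifies the sequent, or follows an edge of the cyclic proof. -/
def SimStep (pf : Preproof (KDer P V)) (R : BRule P V) (t : List ℕ) (s : BSeq P V) (t' : List ℕ)
    (s' : BSeq P V) (Ξ : List ℕ) : Prop :=
  s.raw.control <+: Ξ ∧ Ξ.Nodup ∧ s'.raw.control.Sublist Ξ ∧
    ((t' = t ∧ s'.measure < s.measure ∧
      Tracks (fun b => R.IsReset b) Ξ s.raw.forms s'.raw.forms (fun z c z' => c = false ∧ z' = z)) ∨
    (pf.Edge t t' ∧ Tracks (fun b => R.IsReset b) Ξ s.raw.forms s'.raw.forms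
      (pf.edgeTrace (KTrace P V) t t')))

theorem exists_simStep {pf : Preproof (KDer P V)} (hpf : pf.Closed) {B : ℕ}
    (hB : ∀ t ∈ pf.tree.nodes, (nuPositions (pf.label t).forms).ncard ≤ B) {t : List ℕ}
    {s : BSeq P V} (h : IsState pf B t s) :
    ∃ R : BRule P V, R.raw.concl = s.raw ∧ ∀ (i : ℕ) (hi : i < R.raw.prems.length),
      ∃ t' s', s'.raw = R.raw.prems[i] ∧ IsState pf B t' s' ∧ ∃ Ξ, SimStep pf R t s t' s' Ξ := by
  obtain ⟨ht, hform, hlet⟩ := h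
  by_cases hs : s.Normal
  swap
  · obtain ⟨R, s', h1, h2, h3, h4, h5, h6⟩ := BSeq.exists_simplify hs
    refine ⟨R, h1, fun i hi => ⟨t, s', ?_, ⟨ht, h3.trans hform, fun a ha => hlet a (h4.subset ha)⟩,
      s.raw.control, List.prefix_rfl, s.wf.1, h4, .inl ⟨rfl, h5, h6⟩⟩⟩
    have hi' := hi
    rw [h2, List.length_singleton, Nat.lt_one_iff] at hi'
    subst hi'
    simp [h2]
  cases hb : pf.tree.back t with
  | some c =>
    -- The companion is inner, hence no bud, hence the conclusion of a rule; so the sequent it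
    -- shares with the bud is nonempty.
    obtain ⟨hc, i, hi⟩ := pf.tree.back_inner hb
    have hbc : pf.tree.back c = none := by
      cases h : pf.tree.back c with
      | none => rfl
      | some d => exact absurd hi ((pf.tree.back_leaf h).2 i)
    obtain ⟨R, hR⟩ := hpf.exists_rule hc hbc
    have hne : (BForm.erase '' s.raw.forms).Nonempty := by
      rw [hform, pf.label_back hb, pf.rule_concl hR]
      exact R.raw.concl_nonempty
    obtain ⟨φ, hφ⟩ := Set.image_nonempty.1 hne
    -- Weakening by a formula that also remains in the context only trims the control, and so
    -- provides a rule instance for the passage to the companion.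
    have hconcl : BRaw.concl (.wk s.raw.control s.raw.forms φ) = s.raw := by
      rw [BRaw.concl, Set.union_eq_self_of_subset_right (Set.singleton_subset_iff.2 hφ)]
    have hwf : (trim s.raw.control s.raw.forms).WF := trim_wf s.wf
    refine ⟨⟨.wk s.raw.control s.raw.forms φ, trivial, by rw [hconcl]; exact s.wf,
      by simpa [BRaw.prems] using hwf⟩, hconcl, fun i hi => ⟨c, ⟨_, hwf⟩, ?_, ⟨hc, ?_, ?_⟩,
      s.raw.control, List.prefix_rfl, s.wf.1, trim_control_sublist _ _, .inr ⟨.inr hb, ?_⟩⟩⟩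
    · simp [BRaw.prems]
    · rw [← pf.label_back hb]; exact hform
    · exact fun a ha => hlet a ((trim_control_sublist _ _).subset ha)
    · rintro z d z' (⟨R', j, hR', -⟩ | ⟨-, hz, rfl, rfl⟩) φ hφ e u hu
      · have := (pf.rule_node hR').2
        rw [this] at hb
        cases hb
      · exact ⟨φ, hφ, e, u, hu, .inl rfl, fun h => absurd h (by decide)⟩
  | none =>
    obtain ⟨K, hK⟩ := hpf.exists_rule ht hb
    have hc : BForm.erase '' s.raw.forms = K.raw.concl := by
      rw [hform, pf.rule_concl hK]
      rfl
    have hlen : s.raw.control.length ≤ B := by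
      refine hs.length_le.trans ?_
      rw [hform]
      exact hB t ht
    -- A control of length at most `B` misses one of the `B + 1` letters `0, …, B`.
    obtain ⟨a, ha, ha'⟩ : ∃ a ∈ Finset.range (B + 1), a ∉ s.raw.control.toFinset := by
      refine Finset.exists_mem_notMem_of_card_lt_card ?_
      rw [Finset.card_range]
      exact Nat.lt_succ_of_le ((List.toFinset_card_le _).trans hlen)
    obtain ⟨b, Ξ, hside, hconcl, hpre, hnd, hΞ, hl, hlift⟩ :=
      hs.exists_lift K.side hc (a := a) (by simpa using ha')
    have hwf : ∀ (i : ℕ) (h : i < b.prems.length), (b.prems[i]).WF := by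
      intro i h
      have hL := hlift i h (hl ▸ h)
      refine ⟨hnd.sublist hL.control, hL.finite, fun φ hφ => ⟨?_, hL.annots φ hφ⟩⟩
      exact (K.prems_wf _ (List.getElem_mem (hl ▸ h))).2 _ (hL.image ▸ ⟨φ, hφ, rfl⟩)
    refine ⟨⟨b, hside, by rw [hconcl]; exact s.wf, fun Δ hΔ => ?_⟩, hconcl, fun i hi => ?_⟩
    · obtain ⟨i, hi, rfl⟩ := List.getElem_of_mem hΔ
      exact hwf i hi
    · have hi' : i < K.raw.prems.length := hl ▸ hi
      have hL := hlift i hi hi'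
      refine ⟨t ++ [i], ⟨_, hwf i hi⟩, rfl, ⟨(pf.rule_children hK i).2 hi', ?_, ?_⟩, Ξ, hpre, hnd,
        hL.control, .inr ⟨.inl ⟨K, hK, i, hi', rfl⟩, ?_⟩⟩
      · rw [pf.rule_prem hK ⟨i, hi'⟩]
        exact hL.image
      · intro c hc
        rcases hΞ c (hL.control.subset hc) with hc | rfl
        · exact hlet c hc
        · simpa [Nat.lt_succ_iff] using ha
      · rintro z d z' (⟨K', j, hK', e, -, -, hz⟩ | ⟨hb', -⟩) φ hφ e' u hu
        · rw [hK] at hK'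
          obtain rfl := Option.some.inj hK'
          obtain rfl : i = j := by simpa using e
          obtain ⟨φ', h1, h2, u', h3, h4, h5⟩ := hL.tracks z d z' hz φ hφ e' u hu
          refine ⟨φ', h1, h2, u', h3, ?_, h5⟩
          rcases h4 with h | h | ⟨_, h, -⟩
          exacts [.inl h, .inr (.inl h), h.elim]
        · exact absurd hb hb'

/-- Every infinite simulation of a proof contains a good repeat. -/
theorem exists_goodRepeat {pf : Preproof (KDer P V)} (hpf : pf ∈ (Kmu P V).proofs) {B : ℕ}
    {t : ℕ → List ℕ} {s : ℕ → BSeq P V} {R : ℕ → BRule P V} (h0 : t 0 = [])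
    (hst : ∀ i, IsState pf B (t i) (s i))
    (hstep : ∀ i, ∃ Ξ, SimStep pf (R i) (t i) (s i) (t (i + 1)) (s (i + 1)) Ξ) :
    ∃ m n, m < n ∧ GoodRepeat s R m n := by
  classical
  choose Ξ hpre hnd hsub hstep using hstep
  let M : ℕ → Prop := fun i => pf.Edge (t i) (t (i + 1)) ∧
    Tracks (fun b => (R i).IsReset b) (Ξ i) (s i).raw.forms (s (i + 1)).raw.forms
      (pf.edgeTrace (KTrace P V) (t i) (t (i + 1)))
  have hidle : ∀ i, ¬ M i → t (i + 1) = t i ∧ (s (i + 1)).measure < (s i).measure ∧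
      Tracks (fun b => (R i).IsReset b) (Ξ i) (s i).raw.forms (s (i + 1)).raw.forms
        (fun z c z' => c = false ∧ z' = z) := fun i hi => (hstep i).resolve_right hi
  -- Simplifications lower the measure, so they cannot go on forever.
  have hfreq : ∃ᶠ i in atTop, M i := by
    by_contra hcon
    obtain ⟨N, hN⟩ := eventually_atTop.1 (not_frequently.1 hcon)
    have hdec : ∀ n, (s (N + n)).measure + n ≤ (s N).measure := by
      intro n
      induction n with
      | zero => simp
      | succ n ih =>
        have := (hidle (N + n) (hN _ (by omega))).2.1
        change (s (N + n + 1)).measure + (n + 1) ≤ _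
        omega
    have := hdec ((s N).measure + 1)
    omega
  have hinf : {i | M i}.Infinite := Nat.frequently_atTop_iff_infinite.1 hfreq
  -- The node at the `k`-th move. The node is constant between moves, so these form a branch.
  let π : ℕ → List ℕ := fun k => t (Nat.nth M k)
  have htπ : ∀ i, t i = π (Nat.count M i) := by
    -- Induction on the number of steps before the next move.
    have key : ∀ d i, Nat.nth M (Nat.count M i) = i + d → t i = π (Nat.count M i) := by
      intro d
      induction d with
      | zero => intro i hi; simp only [π]; rw [hi]; rfl
      | succ d ih =>
        intro i hi
        have hMi : ¬ M i := fun h => by rw [Nat.nth_count h] at hi; omega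
        have hc : Nat.count M (i + 1) = Nat.count M i := by rw [Nat.count_succ, if_neg hMi]; rfl
        rw [← (hidle i hMi).1, ← hc]
        exact ih (i + 1) (by rw [hc, hi]; omega)
    intro i
    obtain ⟨d, hd⟩ := Nat.exists_eq_add_of_le (Nat.le_nth_count hinf i)
    exact key d i hd
  have hπ : pf.tree.IsBranch π := by
    refine Preproof.isBranch_of_edge ?_ (fun k => (hst _).1) fun k => ?_
    · have := htπ 0
      rw [Nat.count_zero] at this
      rw [← this, h0]
    · have hM : M (Nat.nth M k) := Nat.nth_mem_of_infinite hinf k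
      have h1 := htπ (Nat.nth M k + 1)
      rw [Nat.count_succ, if_pos hM, Nat.count_nth_of_infinite hinf] at h1
      have := hM.1
      rwa [h1] at this
  obtain ⟨N, y, d, hy, hd⟩ := (hpf.2 π hπ).exists_run
  have hy : ∀ n ≥ N, pf.edgeTrace (KTrace P V) (π n) (π (n + 1)) (y n) (d n) (y (n + 1)) := hy
  let I := Nat.nth M N
  have hI : ∀ i, N ≤ Nat.count M (I + i) := fun i =>
    (Nat.count_nth_of_infinite hinf N).ge.trans (Nat.count_monotone M (Nat.le_add_right I i))
  -- The trace in the time of the simulation: it waits while the sequent is being simplified.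
  let z : ℕ → Form P V × List Bool := fun i => y (Nat.count M i)
  have hzM : ∀ i, M i → z (i + 1) = y (Nat.count M i + 1) ∧ t (i + 1) = π (Nat.count M i + 1) := by
    intro i hi
    have : Nat.count M (i + 1) = Nat.count M i + 1 := by rw [Nat.count_succ, if_pos hi]
    exact ⟨by simp only [z, this], by rw [htπ, this]⟩
  obtain ⟨φ₀, hφ₀, e₀, u₀, hu₀⟩ : ∃ φ ∈ (s I).raw.forms, φ.erase = (z I).1 ∧
      ∃ u, φ.annotAt (z I).2 = some u := by
    have h1 := Preproof.mem_obj_of_edgeTrace (hy _ (hI 0))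
    rw [Nat.add_zero, ← htπ] at h1
    obtain ⟨h1, h2⟩ := h1
    rw [← (hst I).2.1] at h1
    obtain ⟨φ, hφ, e⟩ := h1
    exact ⟨φ, hφ, e, BForm.mem_nuAddr_erase_iff.1 (e ▸ h2)⟩
  obtain ⟨f, -, hf⟩ := exists_chain (α := BForm P V × List ℕ)
    (p := fun n x => x.1 ∈ (s (I + n)).raw.forms ∧ x.1.erase = (z (I + n)).1 ∧
      x.1.annotAt (z (I + n)).2 = some x.2)
    (r := fun n x x' => AnnotStep (fun b => (R (I + n)).IsReset b) (Ξ (I + n)) x.2 x'.2 ∧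
      (M (I + n) → d (Nat.count M (I + n)) = true → StackLt (Ξ (I + n)) x'.2 x.2))
    (φ₀, u₀) ⟨hφ₀, e₀, hu₀⟩ (by
      rintro n ⟨φ, u⟩ ⟨hφ, e, hu⟩
      by_cases hM : M (I + n)
      · have h1 := hy _ (hI n)
        rw [← htπ, ← (hzM _ hM).1, ← (hzM _ hM).2] at h1
        obtain ⟨φ', h2, h3, u', h4, h5, h6⟩ := hM.2 _ _ _ h1 φ hφ e u hu
        exact ⟨(φ', u'), ⟨h2, h3, h4⟩, h5, fun _ => h6⟩
      · have h1 : z (I + (n + 1)) = z (I + n) := by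
          simp only [z]
          rw [← Nat.add_assoc, Nat.count_succ, if_neg hM]
          rfl
        obtain ⟨φ', h2, h3, u', h4, h5, h6⟩ := (hidle _ hM).2.2 _ _ _ ⟨rfl, h1⟩ φ hφ e u hu
        exact ⟨(φ', u'), ⟨h2, h3, h4⟩, h5, fun h => absurd h hM⟩)
  have hact : ∃ᶠ n in atTop, StackLt (Ξ (I + n)) (f (n + 1)).2 (f n).2 := by
    rw [frequently_atTop] at hd ⊢
    intro n
    obtain ⟨k, hk, hdk⟩ := hd (Nat.count M (I + n))
    have hM : M (Nat.nth M k) := Nat.nth_mem_of_infinite hinf k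
    have h1 : I + n ≤ Nat.nth M k := (Nat.le_nth_count hinf _).trans (Nat.nth_monotone hinf hk)
    obtain ⟨m, hm⟩ := Nat.exists_eq_add_of_le h1
    refine ⟨n + m, by omega, (hf (n + m)).2.2 ?_ ?_⟩
    · rw [← Nat.add_assoc, ← hm]; exact hM
    · rw [← Nat.add_assoc, ← hm, Nat.count_nth_of_infinite hinf]; exact hdk
  have hlen : ∀ i, (s i).raw.control.length ≤ B + 1 := by
    intro i
    rw [← List.toFinset_card_of_nodup (s i).wf.1, ← Finset.card_range (B + 1)]
    refine Finset.card_le_card fun a ha => ?_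
    simpa [Nat.lt_succ_iff] using (hst i).2.2 a (by simpa using ha)
  obtain ⟨θ, a, hstab, hres⟩ := exists_stable_reset (Θ := fun n => (s (I + n)).raw.control)
    (Ξ := fun n => Ξ (I + n)) (B := B + 1) (Res := fun n b => (R (I + n)).IsReset b)
    (u := fun n => (f n).2) (fun n => hlen _) (fun n => hpre _) (fun n => hnd _) (fun n => hsub _)
    (Eventually.of_forall fun n => ((s (I + n)).wf.2.2 _ (hf n).1.1).2 _
      (BForm.mem_annots_of_annotAt (hf n).1.2.2))
    (Eventually.of_forall fun n => (hf n).2.1) hact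
  have hL := finite_sequents (pf.tree.finite.biUnion fun t _ => (pf.label t).wf.1) (B + 1)
  -- By finiteness, some sequent recurs infinitely often.
  obtain ⟨l, hl⟩ : ∃ l, ∃ᶠ n in atTop, s (I + n) = l := by
    by_contra hcon
    push Not at hcon
    have h1 := (eventually_all_finite hL).2 fun l _ => hcon l
    obtain ⟨n, hn⟩ := h1.exists
    refine hn (s (I + n)) ⟨fun a ha => Nat.lt_succ_of_le ((hst _).2.2 a ha), ?_⟩ rfl
    rw [(hst _).2.1]
    exact Set.subset_biUnion_of_mem (u := fun t => (pf.label t).forms) (hst _).1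
  obtain ⟨K, hK⟩ := eventually_atTop.1 hstab
  rw [frequently_atTop] at hl hres
  obtain ⟨m, hm, em⟩ := hl K
  obtain ⟨k, hk, hreset⟩ := hres m
  -- The recurrence is taken after time `k`, as the reset must be applied before the bud.
  obtain ⟨n, hn, en⟩ := hl (k + 1)
  refine ⟨I + m, I + n, by omega, em.trans en.symm, θ, a, fun j hj _ => ?_, I + k, by omega,
    by omega, hreset⟩
  obtain ⟨j, rfl⟩ := Nat.exists_eq_add_of_le ((Nat.le_add_right I m).trans hj)
  exact hK j (by omega)

/-- The boolean reset system proves what the cyclic system proves. -/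
theorem rkmuBProves_of_kmu {Γ : KSeq P V} (h : (Kmu P V).Proves Γ) : RKmuBProves Γ := by
  classical
  obtain ⟨pf, hpf, rfl⟩ := h
  obtain ⟨B, hB⟩ : ∃ B, ∀ t ∈ pf.tree.nodes, (nuPositions (pf.label t).forms).ncard ≤ B := by
    obtain ⟨B, hB⟩ := (pf.tree.finite.image
      fun t => (nuPositions (pf.label t).forms).ncard).bddAbove
    exact ⟨B, fun t ht => hB ⟨t, ht, rfl⟩⟩
  have hex := fun x : {x : List ℕ × BSeq P V // IsState pf B x.1 x.2} =>
    exists_simStep hpf.1 hB x.2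
  choose R hR nt ns hns hst hsim using hex
  let nx : {x : List ℕ × BSeq P V // IsState pf B x.1 x.2} → ℕ →
      {x : List ℕ × BSeq P V // IsState pf B x.1 x.2} := fun x i =>
    -- Indices without a premise get a dummy value, which no play uses.
    if h : i < (R x).raw.prems.length then ⟨(nt x i h, ns x i h), hst x i h⟩ else x
  have hnx : ∀ x i (h : i < (R x).raw.prems.length),
      nx x i = ⟨(nt x i h, ns x i h), hst x i h⟩ := fun x i h => dif_pos h
  have hstart : IsState pf B [] (KSeq.start pf.endsequent) := by
    refine ⟨pf.tree.root_mem, ?_, fun a ha => by cases ha⟩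
    change BForm.erase '' (Form.annot '' _) = _
    simp only [Set.image_image, Form.erase_annot, Set.image_id']
    rfl
  refine proves_of_strategy (fun x => x.1.2) R nx (fun x => ?_) (fun x i => ?_)
    ⟨([], KSeq.start pf.endsequent), hstart⟩ fun f h0 hf => ?_
  · exact BSeq.ext (hR x).symm
  · rw [hnx x i i.2]
    exact BSeq.ext (hns x i i.2)
  · refine exists_goodRepeat hpf (B := B) (t := fun n => (f n).1.1) (by simp only [h0])
      (fun n => (f n).2) fun n => ?_
    obtain ⟨i, hi, e⟩ := hf n
    simp only [Function.comp]
    rw [e, hnx _ i hi]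
    exact hsim _ i hi

end ModalMu

theorem mainTheorem12 {P : Type*} {V : Type*} (Γ : ModalMu.KSeq P V)
    (h : (ModalMu.Kmu P V).Proves Γ) : ModalMu.RKmuBProves Γ :=
  ModalMu.rkmuBProves_of_kmu h
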